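/- Let $I\subseteq\mathbb R$ be an interval and let $x_1(t)<\dots<x_n(t)$ and $m_1(t),\dots,m_n(t)\neq 0$ (of arbitrary signs), $t\in I$, be a multipeakon/antipeakon solution of the Camassa–Holm equation: with $u(\xi,t)=\frac12\sum_{k=1}^n m_k(t)e^{-2|\xi-x_k(t)|}$, $$\dot x_j=u(x_j,t),\qquad \dot m_j=-\langle u_x(x_j,t)\rangle\, m_j,\qquad 1\le j\le n,$$ where $\langle u_x(x_j)\rangle$ is the average of the left and right limits of $u_x$ at $x_j$. Put $y_0=-1$, $y_j=\tanh x_j$ $(1\le j\le n)$, $y_{n+1}=1$, $l_j=y_{j+1}-y_j$ $(0\le j\le n)$ and $g_j=m_j/(1-y_j^2)$ $(1\le j\le n)$. For $z\in\mathbb C$ let $\varphi(\cdot,z)$ be the continuous piecewise linear solution on $[-1,1]$ of $\varphi''=z\sum_j g_j\delta_{y_j}\varphi$ with $\varphi(-1,z)=0$ and slope $1$ on $(y_0,y_1)$, and let $w(z)=\varphi'(1^-,z)/\varphi(1,z)$. Then there are distinct nonzero real numbers $\lambda_1,\dots,\lambda_n$ and constants $a_1(0),\dots,a_n(0)>0$,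 all independent of $t$, such that with $a_j(t)=a_j(0)e^{-2t/\lambda_j}$ the following holds for every $t\in I$. The zeros of $\varphi(1,\cdot)$ in $\mathbb C$ are exactly $\lambda_1,\dots,\lambda_n$, and $$\frac{w(z)}z=\frac1{2z}+\sum_{j=1}^n\frac{a_j(t)}{z-\lambda_j}.$$ Let $\mu=\frac12\delta_0+\sum_{j=1}^n a_j(t)\,\delta_{-\lambda_j}$, $A_k=\int\lambda^k\,d\mu(\lambda)$, let $\Delta_k=\det(A_{i+j})_{0\le i,j<k}$ (with $\Delta_0=1$), let $$P_j(\lambda)=\frac1{(\Delta_{j+1}\Delta_j)^{1/2}}\begin{vmatrix}A_0&A_1&\dots&A_j\\ A_1&A_2&\dots&A_{j+1}\\ \vdots&&&\vdots\\ A_{j-1}&A_j&\dots&A_{2j-1}\\ 1&\lambda&\dots&\lambda^j\end{vmatrix}\quad(0\le j\le n),\qquad b_j=\frac{(\Delta_j\Delta_{j+2})^{1/2}}{\Delta_{j+1}}\quad(0\le j\le n-1).$$ The polynomials $P_0,\dots,P_n$ have degrees $0,\dots,n$ and are orthonormal in $L^2(\mathbb R,d\mu)$, and, with primes denoting derivatives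 in $\lambda$, $$l_j=P_{n-j}(0)^2\quad(0\le j\le n),\qquad g_j=-\frac1{b_{n-j}P_{n-j+1}(0)P_{n-j}(0)}\quad(1\le j\le n),$$ $$y_j=1+b_{n-j}\big(P_{n-j}'(0)P_{n-j+1}(0)-P_{n-j}(0)P_{n-j+1}'(0)\big)\quad(1\le j\le n).$$ -/

import Mathlib

open Polynomial MeasureTheory

noncomputable section

namespace Multipeakon

/-! Indices of peaks, masses and eigenvalues are natural numbers running through `1, …, n`;
the values of the families outside that range play no role. -/

/-- The multipeakon profile `u(ξ) = ½ ∑ m_k exp(-2|ξ - x_k|)`. -/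
def profile (n : ℕ) (x m : ℕ → ℝ) (ξ : ℝ) : ℝ :=
  (1 / 2) * ∑ k ∈ Finset.Icc 1 n, m k * Real.exp (-2 * |ξ - x k|)

/-- The slope of `profile`. `Real.sign 0 = 0`, so at a peak `ξ = x_k` this is the
average of the limits of the slope from the left and from the right. -/
def meanSlope (n : ℕ) (x m : ℕ → ℝ) (ξ : ℝ) : ℝ :=
  -∑ k ∈ Finset.Icc 1 n, m k * Real.sign (ξ - x k) * Real.exp (-2 * |ξ - x k|)

/-- `(x_j(t), m_j(t))`, `1 ≤ j ≤ n`, is a multipeakon/antipeakon solution on the time set `I`: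
the peaks are distinct and ordered, the weights (of either sign) are nonzero, and
`ẋ_j = u(x_j)`, `ṁ_j = -⟨u_x(x_j)⟩ m_j`. -/
structure IsSolution (n : ℕ) (x m : ℕ → ℝ → ℝ) (I : Set ℝ) : Prop where
  ordered : ∀ t ∈ I, ∀ i j, 1 ≤ i → i < j → j ≤ n → x i t < x j t
  weight_ne : ∀ t ∈ I, ∀ j, 1 ≤ j → j ≤ n → m j t ≠ 0
  pos_ode : ∀ t ∈ I, ∀ j, 1 ≤ j → j ≤ n →
    HasDerivWithinAt (x j) (profile n (fun k => x k t) (fun k => m k t) (x j t)) I t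
  weight_ode : ∀ t ∈ I, ∀ j, 1 ≤ j → j ≤ n →
    HasDerivWithinAt (m j)
      (-(meanSlope n (fun k => x k t) (fun k => m k t) (x j t)) * m j t) I t

/-- Positions on the string: `y_0 = -1`, `y_j = tanh x_j` for `1 ≤ j ≤ n`, `y_{n+1} = 1`. -/
def stringPos (n : ℕ) (x : ℕ → ℝ) (j : ℕ) : ℝ :=
  if j = 0 then -1 else if j ≤ n then Real.tanh (x j) else 1

/-- Lengths of the subintervals: `l_j = y_{j+1} - y_j`, `0 ≤ j ≤ n`. -/
def stringLen (n : ℕ) (x : ℕ → ℝ) (j : ℕ) : ℝ :=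
  stringPos n x (j + 1) - stringPos n x j

/-- Masses on the string: `m_j = g_j (1 - y_j²)`, `1 ≤ j ≤ n`. -/
def stringMass (n : ℕ) (x m : ℕ → ℝ) (j : ℕ) : ℝ :=
  m j / (1 - stringPos n x j ^ 2)

/-- The solution of `φ'' = z g φ`, `φ(-1) = 0`, `φ'(-1) = 1`, for the discrete mass
`g = ∑ g_j δ_{y_j}`: the pair is `(φ(y_j, z), D₊φ(y_j, z))`. The function is linear with slope
`D₊φ(y_j) = D₋φ(y_{j+1})` between `y_j` and `y_{j+1} = y_j + l_j`, and its slope jumps by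
`z g_{j+1} φ(y_{j+1})` at `y_{j+1}`. -/
def wave (l g : ℕ → ℝ) (z : ℂ) : ℕ → ℂ × ℂ
  | 0 => (0, 1)
  | j + 1 =>
    ((wave l g z j).1 + l j * (wave l g z j).2,
      (wave l g z j).2 + z * g (j + 1) * ((wave l g z j).1 + l j * (wave l g z j).2))

/-- `φ(1, z)`. -/
def waveEnd (n : ℕ) (l g : ℕ → ℝ) (z : ℂ) : ℂ := (wave l g z (n + 1)).1

/-- `D₋φ(1, z)`, which is the slope on the last interval `(y_n, 1)`. -/
def waveEndSlope (n : ℕ) (l g : ℕ → ℝ) (z : ℂ) : ℂ := (wave l g z n).2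

/-- The Weyl function `w(z) = D₋φ(1, z) / φ(1, z)`. -/
def weyl (n : ℕ) (l g : ℕ → ℝ) (z : ℂ) : ℂ := waveEndSlope n l g z / waveEnd n l g z

/-- `λ_1, …, λ_n` are the eigenvalues of the string (the zeros of `φ(1, ·)` in `ℂ`; they are
real, nonzero and distinct), and `a_1, …, a_n` are the residues in
`w(z)/z = 1/(2z) + ∑ a_j / (z - λ_j)`. -/
structure IsSpectralData (n : ℕ) (l g lam a : ℕ → ℝ) : Prop where
  ne_zero : ∀ j, 1 ≤ j → j ≤ n → lam j ≠ 0
  distinct : ∀ i j, 1 ≤ i → i < j → j ≤ n → lam i ≠ lam j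
  roots : ∀ z : ℂ, waveEnd n l g z = 0 ↔ ∃ j, 1 ≤ j ∧ j ≤ n ∧ z = lam j
  weyl_eq : ∀ z : ℂ, z ≠ 0 → waveEnd n l g z ≠ 0 →
    weyl n l g z / z = 1 / (2 * z) + ∑ j ∈ Finset.Icc 1 n, (a j : ℂ) / (z - lam j)

/-- The measure `½ δ_0 + ∑ a_j δ_{-λ_j}` (for `a_j ≥ 0`). -/
def spectralMeasure (n : ℕ) (lam a : ℕ → ℝ) : Measure ℝ :=
  ENNReal.ofReal (1 / 2) • Measure.dirac 0 +
    ∑ j ∈ Finset.Icc 1 n, ENNReal.ofReal (a j) • Measure.dirac (-lam j)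

/-- The moments `A_k = ∫ s^k dμ(s)`. -/
def moment (μ : Measure ℝ) (k : ℕ) : ℝ := ∫ s, s ^ k ∂μ

/-- The `k × k` Hankel determinant `Δ_k^0 = det (A_{i+j})`, `0 ≤ i, j < k`. -/
def hankel (μ : Measure ℝ) (k : ℕ) : ℝ :=
  (Matrix.of fun i j : Fin k => moment μ ((i : ℕ) + (j : ℕ))).det

/-- The orthonormal polynomial `P_j` of `μ`: `(Δ_{j+1}^0 Δ_j^0)^{-1/2}` times the determinant
with rows `(A_i, …, A_{i+j})` for `0 ≤ i < j`, and last row `(1, X, …, X^j)`. -/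
def orthoPoly (μ : Measure ℝ) (j : ℕ) : ℝ[X] :=
  C (1 / Real.sqrt (hankel μ (j + 1) * hankel μ j)) *
    (Matrix.of fun i k : Fin (j + 1) =>
      if (i : ℕ) < j then C (moment μ ((i : ℕ) + (k : ℕ))) else (X : ℝ[X]) ^ (k : ℕ)).det

/-- The off-diagonal coefficient `b_j = (Δ_j^0 Δ_{j+2}^0)^{1/2} / Δ_{j+1}^0` of the recursion
`s P_j = b_j P_{j+1} + d_j P_j + b_{j-1} P_{j-1}`. -/
def recCoeff (μ : Measure ℝ) (j : ℕ) : ℝ :=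
  Real.sqrt (hankel μ j * hankel μ (j + 2)) / hankel μ (j + 1)

/-- `P_0, …, P_n` have degrees `0, …, n` and are orthonormal in `L²(μ)`. -/
def IsOrthonormalUpTo (μ : Measure ℝ) (n : ℕ) (P : ℕ → ℝ[X]) : Prop :=
  (∀ j ≤ n, (P j).degree = j) ∧
    ∀ i ≤ n, ∀ j ≤ n, ∫ s, (P i).eval s * (P j).eval s ∂μ = if i = j then 1 else 0

end Multipeakon

end

noncomputable section

namespace Multipeakon

/-! ### Hankel determinants and orthonormal polynomials -/

section Hankel

variable {μ : Measure ℝ} {n : ℕ} {Q : ℕ → ℝ[X]}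

/-! The map `y = tanh x` turns the peakon flow into an isospectral flow of a discrete string on [-1,
1], and the string is recovered from its spectral data by orthogonal polynomials.

Write D_i for the slopes `slopePoly`, and N(z) = ∑ l_i D_i(z)². `christoffel_darboux` reads
zφ(1,z)D_n(w) - wφ(1,w)D_n(z) = (z-w) ∑ l_i D_i(z)D_i(w). With w conjugate to z it makes the
eigenvalues real; differentiated on the diagonal it makes them simple. At the n+1 zeros of zφ(1,z)
it makes the vectors (D_i) orthogonal with weights l_i. They form a square matrix, so the transposed
relations hold as well (`sum_slope_mul_slope`), and these expand w(z)/z with residues D_n²/N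
(`weyl_div_eq`). At z = 0 the residue is 1/2, because the total length is 2.

For the inverse problem the string is solved from its right end. At every node D_{n-r} is D_n times
a polynomial of degree r in -z (`slopePoly_eq_mul_backSlope`). The factor D_n² is absorbed by the
residue, so the transposed relations say that these polynomials, scaled by ±√l_{n-r}, are
orthonormal for μ. Positive leading coefficients identify them with the determinants P_r
(`orthoPoly_eq`). Values at 0 then give the lengths, ratios of leading coefficients the masses, and
first derivatives at 0 the positions (`reconstruction_formulas`).

In time, (φ, D) obeys a linear Lax equation (`StringFlow.hasDerivWithinAt_string`). At the right end
it shows that φ(1,z) is constant and that D_n decays at rate 2/λ at an eigenvalue λ. By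
`residue_eq_div` the residue is linear in D_n over a constant denominator, so it evolves as
exp(-2t/λ). -/

theorem integral_eval_mul_eval (hμ : ∀ p : ℝ[X], Integrable (fun s => p.eval s) μ)
    {p q : ℝ[X]} {k : ℕ} (hp : p.natDegree < k) (hq : q.natDegree < k) :
    ∫ s, p.eval s * q.eval s ∂μ =
      ∑ a : Fin k, ∑ b : Fin k, p.coeff a * moment μ ((a : ℕ) + (b : ℕ)) * q.coeff b := by
  have h1 : ∀ s : ℝ, p.eval s * q.eval s =
      ∑ a : Fin k, ∑ b : Fin k, p.coeff a * s ^ ((a : ℕ) + (b : ℕ)) * q.coeff b := by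
    intro s
    rw [eval_eq_sum_range' hp, eval_eq_sum_range' hq, ← Fin.sum_univ_eq_sum_range
      (fun i => p.coeff i * s ^ i), ← Fin.sum_univ_eq_sum_range (fun i => q.coeff i * s ^ i),
      Finset.sum_mul_sum]
    refine Finset.sum_congr rfl fun a _ => Finset.sum_congr rfl fun b _ => ?_
    rw [pow_add]; ring
  have hX : ∀ i : ℕ, Integrable (fun s : ℝ => s ^ i) μ := fun i => by simpa using hμ (X ^ i)
  simp_rw [h1]
  rw [integral_finsetSum _ fun a _ => integrable_finsetSum _ fun b _ =>
    ((hX _).const_mul _).mul_const _]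
  refine Finset.sum_congr rfl fun a _ => ?_
  rw [integral_finsetSum _ fun b _ => ((hX _).const_mul _).mul_const _]
  refine Finset.sum_congr rfl fun b _ => ?_
  rw [integral_mul_const, integral_const_mul, moment]

/-- The lower triangular matrix of coefficients of a sequence of polynomials. -/
def coeffMatrix (Q : ℕ → ℝ[X]) (k : ℕ) : Matrix (Fin k) (Fin k) ℝ :=
  Matrix.of fun i a => (Q i).coeff a

theorem det_coeffMatrix (hdeg : ∀ j ≤ n, (Q j).natDegree = j) {k : ℕ} (hk : k ≤ n + 1) :
    (coeffMatrix Q k).det = ∏ j ∈ Finset.range k, (Q j).coeff j := by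
  rw [Matrix.det_of_isLowerTriangular, ← Fin.prod_univ_eq_prod_range (fun j => (Q j).coeff j)]
  · rfl
  · intro i a hia
    have : (i : ℕ) < a := by simpa using hia
    exact coeff_eq_zero_of_natDegree_lt (by rw [hdeg i (by omega)]; exact this)

/-- With T the triangular coefficient matrix of the Q_j and H the Hankel matrix, orthonormality is T
H Tᵀ = 1; take determinants. -/
theorem hankel_eq_prod (hμ : ∀ p : ℝ[X], Integrable (fun s => p.eval s) μ)
    (hdeg : ∀ j ≤ n, (Q j).natDegree = j) (hlead : ∀ j ≤ n, 0 < (Q j).coeff j)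
    (horth : ∀ i ≤ n, ∀ j ≤ n, ∫ s, (Q i).eval s * (Q j).eval s ∂μ = if i = j then 1 else 0)
    {k : ℕ} (hk : k ≤ n + 1) :
    hankel μ k = ∏ j ∈ Finset.range k, ((Q j).coeff j ^ 2)⁻¹ := by
  set H : Matrix (Fin k) (Fin k) ℝ := Matrix.of fun i j => moment μ ((i : ℕ) + (j : ℕ)) with hH
  have h1 : coeffMatrix Q k * H * (coeffMatrix Q k).transpose = 1 := by
    ext i j
    have hi : (i : ℕ) ≤ n := by omega
    have hj : (j : ℕ) ≤ n := by omega
    have := horth i hi j hj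
    rw [integral_eval_mul_eval hμ (k := k) (by rw [hdeg _ hi]; exact i.2)
      (by rw [hdeg _ hj]; exact j.2), Finset.sum_comm] at this
    simp only [Matrix.mul_apply, Finset.sum_mul, coeffMatrix, hH, Matrix.of_apply,
      Matrix.transpose_apply, Matrix.one_apply, this, Fin.ext_iff]
  have h2 := congrArg Matrix.det h1
  rw [Matrix.det_mul, Matrix.det_mul, Matrix.det_transpose, Matrix.det_one,
    det_coeffMatrix hdeg hk] at h2
  have hpos : 0 < ∏ j ∈ Finset.range k, (Q j).coeff j :=
    Finset.prod_pos fun j hj => hlead j (by have := Finset.mem_range.1 hj; omega)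
  rw [Finset.prod_inv_distrib, Finset.prod_pow, hankel, ← hH]
  field_simp
  linarith

/-- Multiplying on the left by the coefficients of Q_0, …, Q_{j-1} and on the right by the
transposed coefficient matrix turns the moment rows into rows of the identity and the row of
monomials into (Q_0, …, Q_j). The product is triangular with determinant Q_j. -/
theorem det_orthoMatrix (hμ : ∀ p : ℝ[X], Integrable (fun s => p.eval s) μ)
    (hdeg : ∀ j ≤ n, (Q j).natDegree = j)
    (horth : ∀ i ≤ n, ∀ j ≤ n, ∫ s, (Q i).eval s * (Q j).eval s ∂μ = if i = j then 1 else 0)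
    {j : ℕ} (hj : j ≤ n) :
    C (((∏ i ∈ Finset.range j, (Q i).coeff i) ^ 2) * (Q j).coeff j) *
      (Matrix.of fun i k : Fin (j + 1) =>
        if (i : ℕ) < j then C (moment μ ((i : ℕ) + (k : ℕ))) else (X : ℝ[X]) ^ (k : ℕ)).det =
      Q j := by
  set M : Matrix (Fin (j + 1)) (Fin (j + 1)) ℝ[X] := Matrix.of fun i k =>
    if (i : ℕ) < j then C (moment μ ((i : ℕ) + (k : ℕ))) else (X : ℝ[X]) ^ (k : ℕ) with hM
  set L : Matrix (Fin (j + 1)) (Fin (j + 1)) ℝ[X] := Matrix.of fun i a =>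
    if (i : ℕ) < j then C ((Q i).coeff a) else if i = a then 1 else 0 with hL
  set R : Matrix (Fin (j + 1)) (Fin (j + 1)) ℝ[X] := (coeffMatrix Q (j + 1)).map C with hR
  have hLdet : L.det = C (∏ i ∈ Finset.range j, (Q i).coeff i) := by
    rw [Matrix.det_of_isLowerTriangular, Fin.prod_univ_castSucc, map_prod,
      ← Fin.prod_univ_eq_prod_range (fun i => C ((Q i).coeff i))]
    · simp [hL]
    · intro i a hia
      have hia : (i : ℕ) < a := by simpa using hia
      have h2 : (i : ℕ) < j := by omega
      simp only [hL, Matrix.of_apply, h2, if_true]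
      rw [coeff_eq_zero_of_natDegree_lt (by rw [hdeg i (by omega)]; exact hia), C_0]
  have hRdet : R.det = C (∏ i ∈ Finset.range (j + 1), (Q i).coeff i) := by
    rw [← det_coeffMatrix hdeg (by omega : j + 1 ≤ n + 1), RingHom.map_det]
    rfl
  have hprod : ∀ i k, (L * M * R.transpose) i k =
      if (i : ℕ) < j then (if i = k then 1 else 0) else Q k := by
    intro i k
    have hk : (k : ℕ) ≤ n := by omega
    have hi : (i : ℕ) ≤ n := by omega
    have hentry : (L * M * R.transpose) i k =
        ∑ a : Fin (j + 1), ∑ b : Fin (j + 1), L i a * M a b * C ((Q k).coeff b) := by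
      simp only [Matrix.mul_apply, Finset.sum_mul]
      rw [Finset.sum_comm]
      rfl
    rw [hentry]
    by_cases h1 : (i : ℕ) < j
    · rw [if_pos h1]
      have hint := integral_eval_mul_eval hμ (k := j + 1) (p := Q i) (q := Q k)
        (by rw [hdeg _ hi]; exact i.2) (by rw [hdeg _ hk]; exact k.2)
      rw [horth i hi k hk] at hint
      have : (if i = k then (1 : ℝ[X]) else 0) = C (if (i : ℕ) = k then 1 else 0) := by
        simp only [Fin.ext_iff]
        split_ifs <;> simp
      rw [this, hint]
      simp only [map_sum]
      refine Finset.sum_congr rfl fun a _ => Finset.sum_congr rfl fun b _ => ?_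
      simp only [hL, hM, Matrix.of_apply, if_pos h1, C_mul]
      -- Row a = j of `M` holds monomials instead of moments, but Q_i with i < j has no coefficient
      -- there.
      by_cases ha : (a : ℕ) < j
      · rw [if_pos ha]
      · rw [coeff_eq_zero_of_natDegree_lt (by rw [hdeg _ hi]; omega)]
        simp
    · rw [if_neg h1]
      have hij : i = Fin.last j := by ext; simp; omega
      rw [Finset.sum_eq_single i]
      · simp only [hL, hM, Matrix.of_apply, if_neg h1, if_true, one_mul]
        rw [Fin.sum_univ_eq_sum_range (fun b => (X : ℝ[X]) ^ b * C ((Q k).coeff b)) (j + 1)]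
        conv_rhs => rw [(Q k).as_sum_range_C_mul_X_pow' (n := j + 1)
          (by rw [hdeg _ hk]; exact k.2)]
        exact Finset.sum_congr rfl fun b _ => mul_comm _ _
      · intro a _ hai
        simp [hL, if_neg h1, if_neg (Ne.symm hai)]
      · simp
  have hdet : (L * M * R.transpose).det = Q j := by
    rw [Matrix.det_of_isLowerTriangular, Fin.prod_univ_castSucc]
    · simp [hprod]
    · intro i a hia
      have hia : (i : ℕ) < a := by simpa using hia
      have h2 : (i : ℕ) < j := by omega
      rw [hprod, if_pos h2, if_neg (by rintro rfl; omega)]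
  rw [Matrix.det_mul, Matrix.det_mul, Matrix.det_transpose, hLdet, hRdet,
    Finset.prod_range_succ] at hdet
  refine Eq.trans ?_ hdet
  simp only [C_mul, C_pow]
  ring

/-- The normalization by Hankel determinants equals the scalar in `det_orthoMatrix`; positive
leading coefficients select the correct sign of the square root. -/
theorem orthoPoly_eq (hμ : ∀ p : ℝ[X], Integrable (fun s => p.eval s) μ)
    (hdeg : ∀ j ≤ n, (Q j).natDegree = j) (hlead : ∀ j ≤ n, 0 < (Q j).coeff j)
    (horth : ∀ i ≤ n, ∀ j ≤ n, ∫ s, (Q i).eval s * (Q j).eval s ∂μ = if i = j then 1 else 0)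
    {j : ℕ} (hj : j ≤ n) : orthoPoly μ j = Q j := by
  have hpos : 0 < ∏ i ∈ Finset.range j, (Q i).coeff i :=
    Finset.prod_pos fun i hi => hlead i (by have := Finset.mem_range.1 hi; omega)
  have hc := hlead j hj
  rw [orthoPoly, hankel_eq_prod hμ hdeg hlead horth (by omega : j + 1 ≤ n + 1),
    hankel_eq_prod hμ hdeg hlead horth (by omega : j ≤ n + 1), Finset.prod_range_succ]
  conv_rhs => rw [← det_orthoMatrix hμ hdeg horth hj]
  congr 2
  rw [Finset.prod_inv_distrib, Finset.prod_pow]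
  set p := ∏ i ∈ Finset.range j, (Q i).coeff i
  have : (p ^ 2)⁻¹ * ((Q j).coeff j ^ 2)⁻¹ * (p ^ 2)⁻¹ = ((p ^ 2 * (Q j).coeff j)⁻¹) ^ 2 := by
    field_simp
  rw [this, Real.sqrt_sq (by positivity)]
  field_simp

theorem recCoeff_eq (hμ : ∀ p : ℝ[X], Integrable (fun s => p.eval s) μ)
    (hdeg : ∀ j ≤ n, (Q j).natDegree = j) (hlead : ∀ j ≤ n, 0 < (Q j).coeff j)
    (horth : ∀ i ≤ n, ∀ j ≤ n, ∫ s, (Q i).eval s * (Q j).eval s ∂μ = if i = j then 1 else 0)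
    {j : ℕ} (hj : j + 1 ≤ n) :
    recCoeff μ j = (Q j).coeff j / (Q (j + 1)).coeff (j + 1) := by
  have hpos : 0 < ∏ i ∈ Finset.range j, (Q i).coeff i :=
    Finset.prod_pos fun i hi => hlead i (by have := Finset.mem_range.1 hi; omega)
  have hc := hlead j (by omega)
  have hc' := hlead (j + 1) hj
  rw [recCoeff, hankel_eq_prod hμ hdeg hlead horth (by omega : j + 1 ≤ n + 1),
    hankel_eq_prod hμ hdeg hlead horth (by omega : j ≤ n + 1),
    hankel_eq_prod hμ hdeg hlead horth (by omega : j + 2 ≤ n + 1),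
    Finset.prod_range_succ, Finset.prod_range_succ]
  rw [Finset.prod_inv_distrib, Finset.prod_pow]
  set p := ∏ i ∈ Finset.range j, (Q i).coeff i
  set c := (Q j).coeff j
  set d := (Q (j + 1)).coeff (j + 1)
  have hsq : (p ^ 2)⁻¹ * ((p ^ 2)⁻¹ * (c ^ 2)⁻¹ * (d ^ 2)⁻¹) = ((p ^ 2 * c * d)⁻¹) ^ 2 := by
    field_simp
  rw [hsq, Real.sqrt_sq (by positivity)]
  field_simp

end Hankel

/-! ### The spectral measure -/

theorem integral_spectralMeasure {n : ℕ} (lam : ℕ → ℝ) {a : ℕ → ℝ}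
    (ha : ∀ j, 1 ≤ j → j ≤ n → 0 ≤ a j) (f : ℝ → ℝ) :
    Integrable f (spectralMeasure n lam a) ∧
    ∫ s, f s ∂(spectralMeasure n lam a) =
      1 / 2 * f 0 + ∑ j ∈ Finset.Icc 1 n, a j * f (-lam j) := by
  have hint : ∀ (c x : ℝ), Integrable f (ENNReal.ofReal c • Measure.dirac x) := fun c x =>
    (integrable_dirac (by simp)).smul_measure ENNReal.ofReal_ne_top
  have hsum : Integrable f
      (∑ j ∈ Finset.Icc 1 n, ENNReal.ofReal (a j) • Measure.dirac (-lam j)) :=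
    integrable_finsetSum_measure.2 fun j _ => hint _ _
  refine ⟨(hint _ _).add_measure hsum, ?_⟩
  rw [spectralMeasure, integral_add_measure (hint _ _) hsum,
    integral_finsetSum_measure fun j _ => hint _ _, integral_smul_measure, integral_dirac]
  congr 1
  · rw [ENNReal.toReal_ofReal (by norm_num), smul_eq_mul]
  · refine Finset.sum_congr rfl fun j hj => ?_
    rw [Finset.mem_Icc] at hj
    -- Nonnegativity of `a` keeps `ENNReal.ofReal` from truncating.
    rw [integral_smul_measure, integral_dirac, ENNReal.toReal_ofReal (ha j hj.1 hj.2), smul_eq_mul]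

/-! ### The string as a pair of polynomials -/

section String

variable (l g : ℕ → ℝ)

/-- `wave` as a pair of polynomials in the spectral variable. -/
def wavePoly : ℕ → ℝ[X] × ℝ[X]
  | 0 => (0, 1)
  | j + 1 =>
    ((wavePoly j).1 + C (l j) * (wavePoly j).2,
      (wavePoly j).2 + X * C (g (j + 1)) * ((wavePoly j).1 + C (l j) * (wavePoly j).2))

/-- The value `φ(y_j)` as a polynomial. -/
def valPoly (j : ℕ) : ℝ[X] := (wavePoly l g j).1

/-- The slope `D₊φ(y_j)` as a polynomial. -/
def slopePoly (j : ℕ) : ℝ[X] := (wavePoly l g j).2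

@[simp] theorem valPoly_zero : valPoly l g 0 = 0 := rfl

@[simp] theorem slopePoly_zero : slopePoly l g 0 = 1 := rfl

theorem valPoly_succ (j : ℕ) :
    valPoly l g (j + 1) = valPoly l g j + C (l j) * slopePoly l g j := rfl

theorem slopePoly_succ (j : ℕ) :
    slopePoly l g (j + 1) = slopePoly l g j + X * C (g (j + 1)) * valPoly l g (j + 1) := rfl

theorem wave_eq_aeval (z : ℂ) (j : ℕ) :
    wave l g z j = (aeval z (valPoly l g j), aeval z (slopePoly l g j)) := by
  induction j with
  | zero => simp [wave]
  | succ j ih => simp [wave, ih, slopePoly_succ, valPoly_succ, mul_comm z]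

theorem waveEnd_eq (n : ℕ) (z : ℂ) : waveEnd n l g z = aeval z (valPoly l g (n + 1)) := by
  rw [waveEnd, wave_eq_aeval]

theorem waveEndSlope_eq (n : ℕ) (z : ℂ) : waveEndSlope n l g z = aeval z (slopePoly l g n) := by
  rw [waveEndSlope, wave_eq_aeval]

theorem eval_zero_slopePoly (j : ℕ) : (slopePoly l g j).eval 0 = 1 := by
  induction j with
  | zero => simp
  | succ j ih => simp [slopePoly_succ, ih]

theorem eval_zero_valPoly (j : ℕ) :
    (valPoly l g j).eval 0 = ∑ i ∈ Finset.range j, l i := by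
  induction j with
  | zero => simp
  | succ j ih => simp [valPoly_succ, ih, eval_zero_slopePoly, Finset.sum_range_succ]

/-- The Christoffel–Darboux identity of the string. -/
theorem christoffel_darboux {A : Type*} [CommRing A] [Algebra ℝ A] (z w : A) (j : ℕ) :
    z * aeval z (valPoly l g (j + 1)) * aeval w (slopePoly l g j) -
      w * aeval w (valPoly l g (j + 1)) * aeval z (slopePoly l g j) =
    (z - w) * ∑ i ∈ Finset.range (j + 1),
      algebraMap ℝ A (l i) * (aeval z (slopePoly l g i) * aeval w (slopePoly l g i)) := by
  induction j with
  | zero => simp [valPoly_succ]; ring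
  | succ j ih =>
    rw [Finset.sum_range_succ, mul_add, ← ih, valPoly_succ l g (j + 1), slopePoly_succ]
    simp only [map_add, map_mul, aeval_C, aeval_X]
    ring

variable {l g} {n : ℕ}

/-- Each interval followed by a mass raises the degree of the slope by one and multiplies its top
coefficient by g_{j+1} l_j. Nonzero masses therefore give φ(1,·) the full degree n. -/
theorem coeff_string (hl : ∀ j ≤ n, 0 < l j) (hg : ∀ j, 1 ≤ j → j ≤ n → g j ≠ 0) {j : ℕ}
    (hj : j ≤ n) :
    (∀ i, j ≤ i → (valPoly l g j).coeff i = 0) ∧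
      (∀ i, j < i → (slopePoly l g j).coeff i = 0) ∧ (slopePoly l g j).coeff j ≠ 0 := by
  induction j with
  | zero => simpa using fun i hi => by simp [coeff_one, hi.ne']
  | succ j ih =>
    obtain ⟨h1, h2, h3⟩ := ih (by omega)
    have hv : ∀ i, j + 1 ≤ i → (valPoly l g (j + 1)).coeff i = 0 := fun i hi => by
      simp [valPoly_succ, h1 i (by omega), h2 i (by omega)]
    refine ⟨hv, fun i hi => ?_, ?_⟩
    · obtain ⟨i, rfl⟩ : ∃ k, i = k + 1 := ⟨i - 1, by omega⟩
      rw [slopePoly_succ, coeff_add, h2 _ (by omega), mul_assoc, coeff_X_mul, coeff_C_mul,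
        hv i (by omega)]
      simp
    · rw [slopePoly_succ, coeff_add, h2 _ (by omega), mul_assoc, coeff_X_mul, coeff_C_mul,
        valPoly_succ, coeff_add, h1 j le_rfl, coeff_C_mul, zero_add, zero_add]
      exact mul_ne_zero (hg _ (by omega) hj) (mul_ne_zero (hl j (by omega)).ne' h3)

theorem natDegree_valPoly_end (hl : ∀ j ≤ n, 0 < l j)
    (hg : ∀ j, 1 ≤ j → j ≤ n → g j ≠ 0) : (valPoly l g (n + 1)).natDegree = n := by
  obtain ⟨h1, h2, h3⟩ := coeff_string hl hg le_rfl
  refine natDegree_eq_of_le_of_coeff_ne_zero (natDegree_le_iff_coeff_eq_zero.2 fun i hi => ?_) ?_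
  · rw [valPoly_succ, coeff_add, coeff_C_mul, h1 i hi.le, h2 i hi]
    simp
  · rw [valPoly_succ, coeff_add, coeff_C_mul, h1 n le_rfl, zero_add]
    exact mul_ne_zero (hl n le_rfl).ne' h3

variable (l g n) in
/-- `∑ l_j D_j(z)²`. -/
def normSq (z : ℝ) : ℝ := ∑ i ∈ Finset.range (n + 1), l i * (slopePoly l g i).eval z ^ 2

theorem normSq_pos (hl : ∀ j ≤ n, 0 < l j) (z : ℝ) : 0 < normSq l g n z := by
  refine Finset.sum_pos' (fun i hi => ?_) ⟨0, by simp, ?_⟩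
  · have := hl i (by have := Finset.mem_range.1 hi; omega)
    positivity
  · simpa using hl 0 (by omega)

theorem derivative_valPoly_mul {z : ℝ} (hz : (valPoly l g (n + 1)).eval z = 0) :
    z * (derivative (valPoly l g (n + 1))).eval z * (slopePoly l g n).eval z =
      normSq l g n z := by
  -- Christoffel–Darboux over `ℝ[X]`, with w frozen at the constant z, can be differentiated in the
  -- first variable and evaluated on the diagonal.
  have h := congrArg (fun p => (derivative p).eval z)
    (christoffel_darboux l g (A := ℝ[X]) X (C z) n)
  have hC : ∀ p : ℝ[X], aeval (C z) p = C (p.eval z) := fun p => by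
    have := aeval_algebraMap_apply ℝ[X] z p
    simpa using this
  simp only [hC, aeval_X_left, AlgHom.id_apply, hz] at h
  simpa [hz, normSq, eval_finsetSum, pow_two] using h

theorem im_eq_zero_of_root (hl : ∀ j ≤ n, 0 < l j) {z : ℂ}
    (hz : aeval z (valPoly l g (n + 1)) = 0) : z.im = 0 := by
  -- With w conjugate to z the kernel is ∑ l_i |D_i|², positive since D_0 = 1, so z must equal its
  -- conjugate.
  have h := christoffel_darboux l g z (starRingEnd ℂ z) n
  have hc : ∀ p : ℝ[X], aeval (starRingEnd ℂ z) p = starRingEnd ℂ (aeval z p) := fun p =>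
    aeval_conj p z
  simp only [hc, hz, map_zero, mul_zero, zero_mul, sub_zero, Complex.mul_conj] at h
  rcases mul_eq_zero.1 h.symm with h | h
  · have := congrArg Complex.im h
    simp at this
    linarith
  · exfalso
    have h2 : ∑ i ∈ Finset.range (n + 1), l i * Complex.normSq (aeval z (slopePoly l g i)) = 0 := by
      simp only [Complex.coe_algebraMap] at h
      exact_mod_cast h
    refine (Finset.sum_pos' (fun i hi => ?_) ⟨0, by simp, ?_⟩).ne' h2
    · exact mul_nonneg (hl i (by have := Finset.mem_range.1 hi; omega)).le (Complex.normSq_nonneg _)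
    · simpa using hl 0 (by omega)

/-- Over ℂ the polynomial splits; a multiple root would be a real common root of p and p', so there
are as many distinct roots as the degree, and each is its own real part. -/
theorem exists_enum_roots {p : ℝ[X]} (hp : p ≠ 0)
    (him : ∀ z : ℂ, aeval z p = 0 → z.im = 0)
    (hsimple : ∀ s : ℝ, p.eval s = 0 → (derivative p).eval s ≠ 0) :
    ∃ lam : ℕ → ℝ, (∀ i j, 1 ≤ i → i < j → j ≤ p.natDegree → lam i ≠ lam j) ∧
      ∀ z : ℂ, aeval z p = 0 ↔ ∃ j, 1 ≤ j ∧ j ≤ p.natDegree ∧ z = lam j := by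
  have hreal : ∀ (q : ℝ[X]) (s : ℝ), aeval (s : ℂ) q = ((q.eval s : ℝ) : ℂ) := fun q s => by
    simpa using aeval_algebraMap_apply ℂ s q
  have hpc : p.map (algebraMap ℝ ℂ) ≠ 0 := (Polynomial.map_ne_zero_iff
    (algebraMap ℝ ℂ).injective).2 hp
  have hnodup : (p.aroots ℂ).Nodup := by
    refine Multiset.nodup_iff_count_le_one.2 fun z => ?_
    by_contra! hz
    rw [aroots, count_roots, one_lt_rootMultiplicity_iff_isRoot hpc, IsRoot, IsRoot,
      derivative_map, eval_map_algebraMap, eval_map_algebraMap] at hz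
    have hzr : z = (z.re : ℂ) := Complex.ext rfl (by simp [him z hz.1])
    rw [hzr, hreal, hreal] at hz
    exact hsimple z.re (by exact_mod_cast hz.1) (by exact_mod_cast hz.2)
  have hcard : Fintype.card (p.rootSet ℂ) = p.natDegree :=
    (card_rootSet_eq_natDegree_iff_of_splits hp (IsAlgClosed.splits _)).2
      ((nodup_aroots_iff_of_splits hp (IsAlgClosed.splits _)).1 hnodup)
  let e : Fin p.natDegree ≃ p.rootSet ℂ := (Fintype.equivFinOfCardEq hcard).symm
  have he : ∀ k, ((e k : ℂ).re : ℂ) = e k := fun k =>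
    Complex.ext rfl (by simp [him _ ((mem_rootSet.1 (e k).2).2)])
  refine ⟨fun j => if h : j - 1 < p.natDegree then (e ⟨j - 1, h⟩ : ℂ).re else 0, ?_, fun z => ⟨?_, ?_⟩⟩
  · intro i j hi hij hj heq
    have h1 : i - 1 < p.natDegree := by omega
    have h2 : j - 1 < p.natDegree := by omega
    simp only [dif_pos h1, dif_pos h2] at heq
    have h3 : (e ⟨i - 1, h1⟩ : ℂ) = e ⟨j - 1, h2⟩ := by rw [← he, heq, he]
    have h4 := e.injective (Subtype.ext h3)
    simp only [Fin.mk.injEq] at h4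
    omega
  · intro hz
    obtain ⟨k, hk⟩ := e.surjective ⟨z, mem_rootSet.2 ⟨hp, hz⟩⟩
    refine ⟨k + 1, by omega, by omega, ?_⟩
    simp only [Nat.add_sub_cancel, k.2, dif_pos, Fin.eta, he k]
    rw [hk]
  · rintro ⟨j, h1, h2, rfl⟩
    have h1 : j - 1 < p.natDegree := by omega
    simp only [dif_pos h1, he]
    exact (mem_rootSet.1 (e _).2).2

/-- The eigenvalues of the string are real and simple. -/
theorem exists_enum_eigenvalues (hl : ∀ j ≤ n, 0 < l j)
    (hg : ∀ j, 1 ≤ j → j ≤ n → g j ≠ 0) :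
    ∃ lam : ℕ → ℝ, (∀ i j, 1 ≤ i → i < j → j ≤ n → lam i ≠ lam j) ∧
      ∀ z : ℂ, waveEnd n l g z = 0 ↔ ∃ j, 1 ≤ j ∧ j ≤ n ∧ z = lam j := by
  have h := exists_enum_roots (p := valPoly l g (n + 1)) ?_
    (fun z => im_eq_zero_of_root hl) fun s hs h0 => ?_
  · simpa only [natDegree_valPoly_end hl hg, ← waveEnd_eq] using h
  · intro h0
    have h1 := eval_zero_valPoly l g (n + 1)
    rw [h0, eval_zero] at h1
    exact (Finset.sum_pos (fun i hi => hl i (by have := Finset.mem_range.1 hi; omega))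
      (by simp)).ne h1
  · have h1 := derivative_valPoly_mul (n := n) hs
    rw [h0, mul_zero, zero_mul] at h1
    exact (normSq_pos hl s).ne h1

/-! ### Orthogonality and the Weyl function -/

/-- The eigenvalues together with `0`. -/
def node (lam : ℕ → ℝ) (k : ℕ) : ℝ := if k = 0 then 0 else lam k

@[simp] theorem node_zero (lam : ℕ → ℝ) : node lam 0 = 0 := rfl

theorem node_of_pos (lam : ℕ → ℝ) {k : ℕ} (hk : 1 ≤ k) : node lam k = lam k :=
  if_neg (by omega)

/-- The residue of `w(z) / z` at an eigenvalue. -/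
def residue (n : ℕ) (l g : ℕ → ℝ) (z : ℝ) : ℝ := (slopePoly l g n).eval z ^ 2 / normSq l g n z

variable {lam : ℕ → ℝ}

/-- The orthogonality relations of the slopes, summed over the spectrum. -/
theorem sum_slope_mul_slope (hl : ∀ j ≤ n, 0 < l j)
    (hinj : ∀ i j, i < j → j ≤ n → node lam i ≠ node lam j)
    (hroot : ∀ k ≤ n, node lam k * (valPoly l g (n + 1)).eval (node lam k) = 0)
    {i j : ℕ} (hi : i ≤ n) (hj : j ≤ n) :
    ∑ k ∈ Finset.range (n + 1), (slopePoly l g i).eval (node lam k) *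
      (slopePoly l g j).eval (node lam k) / normSq l g n (node lam k) =
      if i = j then (l i)⁻¹ else 0 := by
  let M : Matrix (Fin (n + 1)) (Fin (n + 1)) ℝ :=
    Matrix.of fun k j => (slopePoly l g j).eval (node lam k)
  let B : Matrix (Fin (n + 1)) (Fin (n + 1)) ℝ :=
    Matrix.of fun j k => l j * (slopePoly l g j).eval (node lam k) / normSq l g n (node lam k)
  have h1 : M * B = 1 := by
    ext k m
    have hm := normSq_pos (g := g) hl (node lam m)
    have hsum : (M * B) k m = (∑ i ∈ Finset.range (n + 1), l i *
        ((slopePoly l g i).eval (node lam k) * (slopePoly l g i).eval (node lam m))) /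
          normSq l g n (node lam m) := by
      rw [Matrix.mul_apply, Finset.sum_div, ← Fin.sum_univ_eq_sum_range (fun i => l i *
        ((slopePoly l g i).eval (node lam k) * (slopePoly l g i).eval (node lam m)) /
          normSq l g n (node lam m))]
      refine Finset.sum_congr rfl fun i _ => ?_
      simp only [M, B, Matrix.of_apply]
      ring
    rw [hsum]
    by_cases hkm : k = m
    · subst hkm
      rw [Matrix.one_apply_eq, div_eq_one_iff_eq hm.ne', normSq]
      simp only [pow_two]
    · rw [Matrix.one_apply_ne hkm]
      have hne : node lam k ≠ node lam m := by
        rcases lt_or_gt_of_ne (fun h => hkm (Fin.ext h) : (k : ℕ) ≠ m) with h | h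
        · exact hinj _ _ h (by omega)
        · exact (hinj _ _ h (by omega)).symm
      have hcd := christoffel_darboux l g (node lam k) (node lam m) n
      simp only [coe_aeval_eq_eval, hroot _ (show (k : ℕ) ≤ n by omega),
        hroot _ (show (m : ℕ) ≤ n by omega), zero_mul, sub_zero, Algebra.algebraMap_self,
        RingHom.id_apply] at hcd
      rw [(mul_eq_zero.1 hcd.symm).resolve_left (sub_ne_zero.2 hne), zero_div]
  -- There are as many nodes as intervals, so the right inverse is also a left inverse:
  -- orthogonality over intervals becomes orthogonality over nodes.
  have h2 : (B * M) ⟨i, by omega⟩ ⟨j, by omega⟩ =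
      (1 : Matrix (Fin (n + 1)) (Fin (n + 1)) ℝ) ⟨i, by omega⟩ ⟨j, by omega⟩ := by
    rw [mul_eq_one_comm.1 h1]
  have hli := hl i hi
  have h3 : (B * M) ⟨i, by omega⟩ ⟨j, by omega⟩ = l i *
      ∑ k ∈ Finset.range (n + 1), (slopePoly l g i).eval (node lam k) *
      (slopePoly l g j).eval (node lam k) / normSq l g n (node lam k) := by
    rw [Matrix.mul_apply, ← Fin.sum_univ_eq_sum_range (fun k =>
      (slopePoly l g i).eval (node lam k) *
      (slopePoly l g j).eval (node lam k) / normSq l g n (node lam k)), Finset.mul_sum]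
    refine Finset.sum_congr rfl fun k _ => ?_
    simp only [M, B, Matrix.of_apply]
    ring
  rw [h3, Matrix.one_apply] at h2
  simp only [Fin.mk.injEq] at h2
  split_ifs at h2 ⊢ with hij
  · exact eq_inv_of_mul_eq_one_right h2
  · exact (mul_eq_zero.1 h2).resolve_left hli.ne'

/-- The partial fraction expansion of `w(z) / z`. -/
theorem weyl_div_eq (hl : ∀ j ≤ n, 0 < l j)
    (hinj : ∀ i j, i < j → j ≤ n → node lam i ≠ node lam j)
    (hroot : ∀ k ≤ n, node lam k * (valPoly l g (n + 1)).eval (node lam k) = 0)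
    {z : ℂ} (hz : ∀ k ≤ n, z ≠ node lam k) (hz0 : waveEnd n l g z ≠ 0) :
    weyl n l g z / z =
      ∑ k ∈ Finset.range (n + 1), (residue n l g (node lam k) : ℂ) / (z - node lam k) := by
  have hreal : ∀ (q : ℝ[X]) (s : ℝ), aeval (s : ℂ) q = ((q.eval s : ℝ) : ℂ) := fun q s => by
    simpa using aeval_algebraMap_apply ℂ s q
  have hz1 : z ≠ 0 := by simpa using hz 0 (by omega)
  rw [waveEnd_eq] at hz0
  -- At w = ν_k, where wφ(1,w) = 0, Christoffel–Darboux expresses D_n(w)/(z - w) as the kernel sum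
  -- divided by zφ(1,z).
  have hterm : ∀ k ∈ Finset.range (n + 1),
      (residue n l g (node lam k) : ℂ) / (z - node lam k) =
      (∑ i ∈ Finset.range (n + 1), (l i : ℂ) * aeval z (slopePoly l g i) *
        (((slopePoly l g i).eval (node lam k) * (slopePoly l g n).eval (node lam k) /
          normSq l g n (node lam k) : ℝ) : ℂ)) / (z * aeval z (valPoly l g (n + 1))) := by
    intro k hk
    have hk : k ≤ n := by have := Finset.mem_range.1 hk; omega
    have hcd := christoffel_darboux l g z (node lam k : ℂ) n
    simp only [hreal] at hcd
    rw [← Complex.ofReal_mul, hroot k hk, Complex.ofReal_zero, zero_mul, sub_zero] at hcd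
    have hN : (normSq l g n (node lam k) : ℂ) ≠ 0 := by
      exact_mod_cast (normSq_pos (g := g) hl (node lam k)).ne'
    rw [div_eq_div_iff (sub_ne_zero.2 (hz k hk)) (mul_ne_zero hz1 hz0)]
    have hfac : (∑ i ∈ Finset.range (n + 1), (l i : ℂ) * aeval z (slopePoly l g i) *
        (((slopePoly l g i).eval (node lam k) * (slopePoly l g n).eval (node lam k) /
          normSq l g n (node lam k) : ℝ) : ℂ)) =
        (∑ i ∈ Finset.range (n + 1), algebraMap ℝ ℂ (l i) * (aeval z (slopePoly l g i) *
          (((slopePoly l g i).eval (node lam k) : ℝ) : ℂ))) *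
          (((slopePoly l g n).eval (node lam k) / normSq l g n (node lam k) : ℝ) : ℂ) := by
      rw [Finset.sum_mul]
      refine Finset.sum_congr rfl fun i _ => ?_
      push_cast
      simp only [Complex.coe_algebraMap]
      ring
    rw [hfac, mul_right_comm, mul_comm _ (z - _), ← hcd, residue]
    push_cast
    ring
  -- Summing over the nodes first, orthogonality against D_n leaves only the interval i = n.
  rw [Finset.sum_congr rfl hterm, ← Finset.sum_div, Finset.sum_comm]
  have hsum : ∀ i ∈ Finset.range (n + 1), ∑ k ∈ Finset.range (n + 1),
      (l i : ℂ) * aeval z (slopePoly l g i) *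
        (((slopePoly l g i).eval (node lam k) * (slopePoly l g n).eval (node lam k) /
          normSq l g n (node lam k) : ℝ) : ℂ) =
      if i = n then aeval z (slopePoly l g n) else 0 := by
    intro i hi
    have hi : i ≤ n := by have := Finset.mem_range.1 hi; omega
    rw [← Finset.mul_sum, ← Complex.ofReal_sum, sum_slope_mul_slope hl hinj hroot hi le_rfl]
    split_ifs with h
    · subst h
      have : (l i : ℂ) ≠ 0 := by exact_mod_cast (hl i hi).ne'
      push_cast
      field_simp
    · simp
  rw [Finset.sum_congr rfl hsum, Finset.sum_ite_eq', if_pos (by simp), weyl, waveEndSlope_eq,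
    waveEnd_eq, div_div, mul_comm z]

end String

/-! ### The inverse problem -/

section Inverse

/-- The solution of the string equation with `ψ(1) = 0`, `ψ'(1) = 1`, in the variable `s = -z`:
the pair `r` is `(ψ(y_{n-r}), D₊ψ(y_{n-r}))`. -/
def backPoly (n : ℕ) (l g : ℕ → ℝ) : ℕ → ℝ[X] × ℝ[X]
  | 0 => (-C (l n), 1)
  | r + 1 =>
    ((backPoly n l g r).1 - C (l (n - (r + 1))) *
        ((backPoly n l g r).2 + X * C (g (n - r)) * (backPoly n l g r).1),
      (backPoly n l g r).2 + X * C (g (n - r)) * (backPoly n l g r).1)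

/-- The value `ψ(y_{n-r})`. -/
def backVal (n : ℕ) (l g : ℕ → ℝ) (r : ℕ) : ℝ[X] := (backPoly n l g r).1

/-- The slope `D₊ψ(y_{n-r})`. -/
def backSlope (n : ℕ) (l g : ℕ → ℝ) (r : ℕ) : ℝ[X] := (backPoly n l g r).2

variable {n : ℕ} {l g lam a : ℕ → ℝ}

@[simp] theorem backVal_zero : backVal n l g 0 = -C (l n) := rfl

@[simp] theorem backSlope_zero : backSlope n l g 0 = 1 := rfl

theorem backSlope_succ (r : ℕ) : backSlope n l g (r + 1) =
    backSlope n l g r + X * C (g (n - r)) * backVal n l g r := rfl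

theorem backVal_succ (r : ℕ) : backVal n l g (r + 1) =
    backVal n l g r - C (l (n - (r + 1))) * backSlope n l g (r + 1) := rfl

theorem coeff_back (r : ℕ) :
    (∀ i, r < i → (backVal n l g r).coeff i = 0) ∧
      (∀ i, r < i → (backSlope n l g r).coeff i = 0) ∧
      (backVal n l g r).coeff r = -l (n - r) * (backSlope n l g r).coeff r := by
  induction r with
  | zero =>
    refine ⟨fun i hi => ?_, fun i hi => ?_, ?_⟩
    · simp [coeff_C, hi.ne']
    · simp [coeff_one, hi.ne']
    · simp
  | succ r ih =>
    obtain ⟨h1, h2, h3⟩ := ih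
    have hs : ∀ i, r + 1 < i → (backSlope n l g (r + 1)).coeff i = 0 := fun i hi => by
      obtain ⟨i, rfl⟩ : ∃ k, i = k + 1 := ⟨i - 1, by omega⟩
      rw [backSlope_succ, coeff_add, h2 _ (by omega), mul_assoc, coeff_X_mul, coeff_C_mul,
        h1 i (by omega)]
      simp
    refine ⟨fun i hi => ?_, hs, ?_⟩
    · rw [backVal_succ, coeff_sub, h1 i (by omega), coeff_C_mul, hs i hi]
      simp
    · rw [backVal_succ, coeff_sub, h1 _ (by omega), coeff_C_mul]
      ring

theorem coeff_backSlope_succ (r : ℕ) : (backSlope n l g (r + 1)).coeff (r + 1) =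
    -(g (n - r) * l (n - r)) * (backSlope n l g r).coeff r := by
  obtain ⟨-, h2, h3⟩ := coeff_back (n := n) (l := l) (g := g) r
  rw [backSlope_succ, coeff_add, h2 _ (by omega), mul_assoc, coeff_X_mul, coeff_C_mul, h3]
  ring

theorem coeff_backSlope_ne_zero (hl : ∀ j ≤ n, 0 < l j) (hg : ∀ j, 1 ≤ j → j ≤ n → g j ≠ 0)
    {r : ℕ} (hr : r ≤ n) : (backSlope n l g r).coeff r ≠ 0 := by
  induction r with
  | zero => simp
  | succ r ih =>
    rw [coeff_backSlope_succ]
    exact mul_ne_zero (neg_ne_zero.2 (mul_ne_zero (hg _ (by omega) (by omega))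
      (hl _ (by omega)).ne')) (ih (by omega))

theorem eval_zero_backSlope (r : ℕ) : (backSlope n l g r).eval 0 = 1 := by
  induction r with
  | zero => simp
  | succ r ih => simp [backSlope_succ, ih]

theorem eval_zero_backVal (r : ℕ) :
    (backVal n l g r).eval 0 = -∑ i ∈ Finset.range (r + 1), l (n - i) := by
  induction r with
  | zero => simp
  | succ r ih =>
    rw [backVal_succ, eval_sub, eval_mul, eval_zero_backSlope, ih, eval_C,
      Finset.sum_range_succ _ (r + 1)]
    ring

/-- At s = 0 the solution ψ is the straight line of slope 1 vanishing at 1, so the mass g_{n-r}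
contributes minus its distance to the right end. This is how positions enter P_r'(0). -/
theorem eval_zero_derivative_backSlope_succ (r : ℕ) :
    (derivative (backSlope n l g (r + 1))).eval 0 =
      (derivative (backSlope n l g r)).eval 0 -
        g (n - r) * ∑ i ∈ Finset.range (r + 1), l (n - i) := by
  simp [backSlope_succ, eval_zero_backVal, sub_eq_add_neg]

/-- At an eigenvalue the solutions from the two ends of the string are proportional. -/
theorem slopePoly_eq_mul_backSlope {z : ℝ} (hz : z * (valPoly l g (n + 1)).eval z = 0)
    {r : ℕ} (hr : r ≤ n) :
    z * (valPoly l g (n - r)).eval z =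
        z * ((slopePoly l g n).eval z * (backVal n l g r).eval (-z)) ∧
      (slopePoly l g (n - r)).eval z =
        (slopePoly l g n).eval z * (backSlope n l g r).eval (-z) := by
  -- The relation between values carries a factor z because φ(1,0) need not vanish; the slopes feel
  -- φ only through zφ, so the induction still covers the node 0.
  induction r with
  | zero =>
    rw [valPoly_succ] at hz
    simp only [eval_add, eval_mul, eval_C] at hz
    constructor
    · simp
      linarith
    · simp
  | succ r ih =>
    obtain ⟨h1, h2⟩ := ih (by omega)
    have hnr : n - r = n - (r + 1) + 1 := by omega
    have hs : (slopePoly l g (n - (r + 1))).eval z =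
        (slopePoly l g n).eval z * (backSlope n l g (r + 1)).eval (-z) := by
      rw [backSlope_succ]
      have h3 := slopePoly_succ l g (n - (r + 1))
      rw [← hnr] at h3
      have h4 := congrArg (eval z) h3
      simp only [eval_add, eval_mul, eval_C, eval_X] at h4 ⊢
      linear_combination -h4 + h2 - g (n - r) * h1
    refine ⟨?_, hs⟩
    have h3 := valPoly_succ l g (n - (r + 1))
    rw [← hnr] at h3
    have h4 := congrArg (eval z) h3
    rw [backVal_succ]
    simp only [eval_add, eval_mul, eval_C, eval_sub] at h4 ⊢
    linear_combination h1 - z * h4 - z * l (n - (r + 1)) * hs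

/-- The normalizing factor of the orthonormal polynomial `r`. -/
def normFactor (n : ℕ) (l g : ℕ → ℝ) (r : ℕ) : ℝ :=
  √(l (n - r)) * ((backSlope n l g r).coeff r / |(backSlope n l g r).coeff r|)

/-- The quotient in `normFactor` is a sign, chosen to make the leading coefficient positive, and it
squares to 1. -/
theorem normFactor_mul_self (hl : ∀ j ≤ n, 0 < l j) (hg : ∀ j, 1 ≤ j → j ≤ n → g j ≠ 0)
    {r : ℕ} (hr : r ≤ n) : normFactor n l g r * normFactor n l g r = l (n - r) := by
  have h := abs_ne_zero.2 (coeff_backSlope_ne_zero hl hg hr)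
  have h1 := Real.mul_self_sqrt (hl (n - r) (by omega)).le
  rw [normFactor, mul_mul_mul_comm, h1, div_mul_div_comm, abs_mul_abs_self, div_self, mul_one]
  exact mul_self_ne_zero.2 (coeff_backSlope_ne_zero hl hg hr)

theorem normFactor_mul_coeff (hl : ∀ j ≤ n, 0 < l j) (hg : ∀ j, 1 ≤ j → j ≤ n → g j ≠ 0)
    {r : ℕ} (hr : r ≤ n) : normFactor n l g r * (backSlope n l g r).coeff r =
      √(l (n - r)) * |(backSlope n l g r).coeff r| := by
  have h := abs_ne_zero.2 (coeff_backSlope_ne_zero hl hg hr)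
  rw [normFactor]
  field_simp
  rw [sq_abs]

/-- The orthonormal polynomials in terms of the string. -/
def stringPoly (n : ℕ) (l g : ℕ → ℝ) (r : ℕ) : ℝ[X] := C (normFactor n l g r) * backSlope n l g r

theorem coeff_stringPoly_pos (hl : ∀ j ≤ n, 0 < l j) (hg : ∀ j, 1 ≤ j → j ≤ n → g j ≠ 0)
    {r : ℕ} (hr : r ≤ n) : 0 < (stringPoly n l g r).coeff r := by
  rw [stringPoly, coeff_C_mul, normFactor_mul_coeff hl hg hr]
  exact mul_pos (Real.sqrt_pos.2 (hl _ (by omega)))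
    (abs_pos.2 (coeff_backSlope_ne_zero hl hg hr))

theorem natDegree_stringPoly (hl : ∀ j ≤ n, 0 < l j) (hg : ∀ j, 1 ≤ j → j ≤ n → g j ≠ 0)
    {r : ℕ} (hr : r ≤ n) : (stringPoly n l g r).natDegree = r := by
  refine natDegree_eq_of_le_of_coeff_ne_zero (natDegree_le_iff_coeff_eq_zero.2 fun i hi => ?_)
    (coeff_stringPoly_pos hl hg hr).ne'
  rw [stringPoly, coeff_C_mul, (coeff_back r).2.1 i hi, mul_zero]

theorem residue_zero (hsum : ∑ i ∈ Finset.range (n + 1), l i = 2) : residue n l g 0 = 1 / 2 := by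
  simp [residue, normSq, eval_zero_slopePoly, hsum]

theorem integral_eq_sum_node (hsum : ∑ i ∈ Finset.range (n + 1), l i = 2)
    (hl : ∀ j ≤ n, 0 < l j)
    (ha : ∀ j, 1 ≤ j → j ≤ n → a j = residue n l g (lam j)) (f : ℝ → ℝ) :
    Integrable f (spectralMeasure n lam a) ∧ ∫ s, f s ∂(spectralMeasure n lam a) =
      ∑ k ∈ Finset.range (n + 1), residue n l g (node lam k) * f (-node lam k) := by
  have h := integral_spectralMeasure (n := n) lam (a := a) (fun j h1 h2 => by
    rw [ha j h1 h2, residue]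
    have := normSq_pos (g := g) hl (lam j)
    positivity) f
  refine ⟨h.1, ?_⟩
  rw [h.2, Finset.sum_range_succ', node_zero, residue_zero hsum, neg_zero, add_comm]
  congr 1
  rw [Finset.range_eq_Ico, Finset.sum_Ico_add' (fun k => residue n l g (node lam k) *
    f (-node lam k))]
  refine Finset.sum_congr (by ext; simp) fun k hk => ?_
  rw [Finset.mem_Ico] at hk
  rw [node_of_pos lam (by omega), ha k (by omega) (by omega)]

/-- At each node the D_n² in the residue turns the product of backward slopes into D_{n-i} D_{n-j} /
N, which `sum_slope_mul_slope` evaluates. -/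
theorem integral_stringPoly_mul (hsum : ∑ i ∈ Finset.range (n + 1), l i = 2)
    (hl : ∀ j ≤ n, 0 < l j) (hg : ∀ j, 1 ≤ j → j ≤ n → g j ≠ 0)
    (hinj : ∀ i j, i < j → j ≤ n → node lam i ≠ node lam j)
    (hroot : ∀ k ≤ n, node lam k * (valPoly l g (n + 1)).eval (node lam k) = 0)
    (ha : ∀ j, 1 ≤ j → j ≤ n → a j = residue n l g (lam j))
    {i j : ℕ} (hi : i ≤ n) (hj : j ≤ n) :
    ∫ s, (stringPoly n l g i).eval s * (stringPoly n l g j).eval s ∂(spectralMeasure n lam a) =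
      if i = j then 1 else 0 := by
  rw [(integral_eq_sum_node hsum hl ha _).2]
  have hterm : ∀ k ∈ Finset.range (n + 1), residue n l g (node lam k) *
      ((stringPoly n l g i).eval (-node lam k) * (stringPoly n l g j).eval (-node lam k)) =
      normFactor n l g i * normFactor n l g j * ((slopePoly l g (n - i)).eval (node lam k) *
        (slopePoly l g (n - j)).eval (node lam k) / normSq l g n (node lam k)) := by
    intro k hk
    have hk : k ≤ n := by have := Finset.mem_range.1 hk; omega
    rw [(slopePoly_eq_mul_backSlope (hroot k hk) hi).2,
      (slopePoly_eq_mul_backSlope (hroot k hk) hj).2]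
    simp only [residue, stringPoly, eval_mul, eval_C]
    ring
  rw [Finset.sum_congr rfl hterm, ← Finset.mul_sum,
    sum_slope_mul_slope hl hinj hroot (Nat.sub_le n i) (Nat.sub_le n j)]
  by_cases hij : i = j
  · subst hij
    rw [if_pos rfl, if_pos rfl, normFactor_mul_self hl hg hi,
      mul_inv_cancel₀ (hl _ (Nat.sub_le n i)).ne']
  · rw [if_neg hij, if_neg (by omega), mul_zero]

/-- The quotient of leading coefficients recovers the masses. -/
theorem coeff_div_coeff_mul_normFactor (hl : ∀ j ≤ n, 0 < l j)
    (hg : ∀ j, 1 ≤ j → j ≤ n → g j ≠ 0) {r : ℕ} (hr : r + 1 ≤ n) :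
    (stringPoly n l g r).coeff r / (stringPoly n l g (r + 1)).coeff (r + 1) *
      (normFactor n l g r * normFactor n l g (r + 1)) = -(g (n - r))⁻¹ := by
  have h0 := coeff_backSlope_ne_zero hl hg (show r ≤ n by omega)
  have h1 := coeff_backSlope_ne_zero hl hg hr
  have hκ := normFactor_mul_self hl hg (show r ≤ n by omega)
  have hκ1 : normFactor n l g (r + 1) ≠ 0 := fun h => by
    have := normFactor_mul_self hl hg hr
    rw [h, mul_zero] at this
    exact (hl _ (by omega)).ne this
  have hgr := hg (n - r) (by omega) (by omega)
  have hlr := (hl (n - r) (by omega)).ne'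
  rw [stringPoly, stringPoly, coeff_C_mul, coeff_C_mul, coeff_backSlope_succ]
  field_simp
  rw [pow_two, hκ]

/-- Reconstruction of the string from its spectral measure. -/
theorem reconstruction (hsum : ∑ i ∈ Finset.range (n + 1), l i = 2)
    (hl : ∀ j ≤ n, 0 < l j) (hg : ∀ j, 1 ≤ j → j ≤ n → g j ≠ 0)
    (hinj : ∀ i j, i < j → j ≤ n → node lam i ≠ node lam j)
    (hroot : ∀ k ≤ n, node lam k * (valPoly l g (n + 1)).eval (node lam k) = 0)
    (ha : ∀ j, 1 ≤ j → j ≤ n → a j = residue n l g (lam j)) :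
    IsOrthonormalUpTo (spectralMeasure n lam a) n (orthoPoly (spectralMeasure n lam a)) ∧
      (∀ r ≤ n, orthoPoly (spectralMeasure n lam a) r = stringPoly n l g r) ∧
      ∀ r, r + 1 ≤ n → recCoeff (spectralMeasure n lam a) r *
        (normFactor n l g r * normFactor n l g (r + 1)) = -(g (n - r))⁻¹ := by
  have hμ : ∀ p : ℝ[X], Integrable (fun s => p.eval s) (spectralMeasure n lam a) := fun p =>
    (integral_eq_sum_node hsum hl ha _).1
  have hdeg : ∀ j ≤ n, (stringPoly n l g j).natDegree = j := fun j =>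
    natDegree_stringPoly hl hg
  have hlead : ∀ j ≤ n, 0 < (stringPoly n l g j).coeff j := fun j =>
    coeff_stringPoly_pos hl hg
  have horth := fun i (hi : i ≤ n) j (hj : j ≤ n) =>
    integral_stringPoly_mul hsum hl hg hinj hroot ha hi hj
  have hP : ∀ r ≤ n, orthoPoly (spectralMeasure n lam a) r = stringPoly n l g r := fun r hr =>
    orthoPoly_eq hμ hdeg hlead horth hr
  refine ⟨⟨fun j hj => ?_, fun i hi j hj => ?_⟩, hP, fun r hr => ?_⟩
  · rw [hP j hj, degree_eq_natDegree, hdeg j hj]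
    intro h0
    have := hlead j hj
    rw [h0, coeff_zero] at this
    exact this.false
  · rw [hP i hi, hP j hj]
    exact horth i hi j hj
  · rw [recCoeff_eq hμ hdeg hlead horth hr]
    exact coeff_div_coeff_mul_normFactor hl hg hr

/-- The lengths, masses and positions in terms of the orthonormal polynomials. -/
theorem reconstruction_formulas (hsum : ∑ i ∈ Finset.range (n + 1), l i = 2)
    (hl : ∀ j ≤ n, 0 < l j) (hg : ∀ j, 1 ≤ j → j ≤ n → g j ≠ 0)
    (hinj : ∀ i j, i < j → j ≤ n → node lam i ≠ node lam j)
    (hroot : ∀ k ≤ n, node lam k * (valPoly l g (n + 1)).eval (node lam k) = 0)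
    (ha : ∀ j, 1 ≤ j → j ≤ n → a j = residue n l g (lam j)) :
    let μ := spectralMeasure n lam a
    let P := orthoPoly μ
    let b := recCoeff μ
    (∀ j, j ≤ n → l j = (P (n - j)).eval 0 ^ 2) ∧
      (∀ j, 1 ≤ j → j ≤ n →
        g j = -1 / (b (n - j) * (P (n - j + 1)).eval 0 * (P (n - j)).eval 0)) ∧
      ∀ j, 1 ≤ j → j ≤ n → ∑ i ∈ Finset.range j, l i = 2 + b (n - j) *
        ((P (n - j)).derivative.eval 0 * (P (n - j + 1)).eval 0 -
          (P (n - j)).eval 0 * (P (n - j + 1)).derivative.eval 0) := by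
  obtain ⟨-, hP, hb⟩ := reconstruction hsum hl hg hinj hroot ha
  intro μ P b
  have hP0 : ∀ r ≤ n, (P r).eval 0 = normFactor n l g r := fun r hr => by
    simp only [P, μ, hP r hr, stringPoly, eval_mul, eval_C, eval_zero_backSlope, mul_one]
  have hP1 : ∀ r ≤ n, (derivative (P r)).eval 0 =
      normFactor n l g r * (derivative (backSlope n l g r)).eval 0 := fun r hr => by
    simp [P, μ, hP r hr, stringPoly]
  refine ⟨fun j hj => ?_, fun j h1 hj => ?_, fun j h1 hj => ?_⟩
  · rw [hP0 _ (Nat.sub_le n j), pow_two, normFactor_mul_self hl hg (Nat.sub_le n j),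
      Nat.sub_sub_self hj]
  · have h2 := hb (n - j) (by omega)
    rw [Nat.sub_sub_self hj] at h2
    rw [hP0 _ (Nat.sub_le n j), hP0 _ (by omega), mul_assoc, mul_comm (normFactor n l g (n - j + 1)),
      h2, neg_div_neg_eq, one_div, inv_inv]
  · have h2 := hb (n - j) (by omega)
    rw [Nat.sub_sub_self hj] at h2
    have h3 := eval_zero_derivative_backSlope_succ (n := n) (l := l) (g := g) (n - j)
    rw [Nat.sub_sub_self hj] at h3
    rw [hP0 _ (Nat.sub_le n j), hP0 _ (by omega), hP1 _ (Nat.sub_le n j), hP1 _ (by omega), h3]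
    have h4 : ∑ i ∈ Finset.range (n - j + 1), l (n - i) = 2 - ∑ i ∈ Finset.range j, l i := by
      rw [← hsum, eq_sub_iff_add_eq, Finset.range_eq_Ico, Finset.sum_Ico_reflect l 0 (by omega),
        Finset.range_eq_Ico, add_comm]
      have : n + 1 - (n - j + 1) = j := by omega
      rw [this, Nat.sub_zero, Finset.sum_Ico_consecutive l (by omega) (by omega),
        Finset.range_eq_Ico]
    rw [h4]
    have hgj := hg j h1 hj
    -- The derivatives of the r-th backward slope, r = n - j, cancel in the bracket. What remains is
    -- κ_r κ_{r+1} g_j, with κ the normalizing factors, times the length to the right of y_j; the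
    -- first factor times b_r is -1.
    have h5 : recCoeff μ (n - j) * (normFactor n l g (n - j) * normFactor n l g (n - j + 1)) * g j
        = -1 := by
      rw [h2]
      field_simp
    linear_combination (-(2 - ∑ i ∈ Finset.range j, l i)) * h5

end Inverse

/-! ### Time evolution -/

section Evolution

/-- `∑_{k ≤ j} g_k (1 + y_k)²`. -/
def leftSum (y g : ℕ → ℝ) (j : ℕ) : ℝ := ∑ k ∈ Finset.Icc 1 j, g k * (1 + y k) ^ 2

/-- `∑_{j < k ≤ n} g_k (1 - y_k)²`. -/
def rightSum (n : ℕ) (y g : ℕ → ℝ) (j : ℕ) : ℝ := ∑ k ∈ Finset.Ioc j n, g k * (1 - y k) ^ 2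

theorem leftSum_zero (y g : ℕ → ℝ) : leftSum y g 0 = 0 := by simp [leftSum]

theorem leftSum_succ (y g : ℕ → ℝ) (j : ℕ) :
    leftSum y g (j + 1) = leftSum y g j + g (j + 1) * (1 + y (j + 1)) ^ 2 :=
  Finset.sum_Icc_succ_top (by omega) _

theorem rightSum_self (n : ℕ) (y g : ℕ → ℝ) : rightSum n y g n = 0 := by simp [rightSum]

theorem rightSum_of_lt {n : ℕ} (y g : ℕ → ℝ) {j : ℕ} (hj : j + 1 ≤ n) :
    rightSum n y g j = rightSum n y g (j + 1) + g (j + 1) * (1 - y (j + 1)) ^ 2 := by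
  rw [rightSum, rightSum, ← Finset.insert_Ioc_add_one_left_eq_Ioc (by omega : j < n),
    Finset.sum_insert (by simp), add_comm]

variable {n : ℕ} {y g : ℕ → ℝ → ℝ} {I : Set ℝ} {t : ℝ}

/-- The evolution of the positions and masses of the string: with
`U(η) = ½ ((1 - η)² leftSum + (1 + η)² rightSum)` on each interval, `ẏ_j = U(y_j)` and
`ġ_j = -⟨U'(y_j)⟩ g_j`. -/
structure StringFlow (n : ℕ) (y g : ℕ → ℝ → ℝ) (I : Set ℝ) (t : ℝ) : Prop where
  left_end : ∀ s, y 0 s = -1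
  right_end : ∀ s, y (n + 1) s = 1
  pos : ∀ j, 1 ≤ j → j ≤ n → HasDerivWithinAt (y j)
    (((1 - y j t) ^ 2 * leftSum (y · t) (g · t) j +
      (1 + y j t) ^ 2 * rightSum n (y · t) (g · t) j) / 2) I t
  mass : ∀ j, j + 1 ≤ n → HasDerivWithinAt (g (j + 1))
    (((1 - y (j + 1) t) * (leftSum (y · t) (g · t) j + leftSum (y · t) (g · t) (j + 1)) -
      (1 + y (j + 1) t) * (rightSum n (y · t) (g · t) j + rightSum n (y · t) (g · t) (j + 1))) / 2 *
        g (j + 1) t) I t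

theorem StringFlow.hasDerivWithinAt_pos (h : StringFlow n y g I t) {j : ℕ} (hj : j ≤ n) :
    HasDerivWithinAt (y j) (((1 - y j t) ^ 2 * leftSum (y · t) (g · t) j +
      (1 + y j t) ^ 2 * rightSum n (y · t) (g · t) j) / 2) I t := by
  rcases Nat.eq_zero_or_pos j with rfl | h1
  · have h0 : y 0 = fun _ => -1 := funext h.left_end
    rw [leftSum_zero, h0]
    simpa using hasDerivWithinAt_const t I (-1 : ℝ)
  · exact h.pos j h1 hj

/-- The velocity U is continuous at each knot, so both ends of the j-th interval can be moved by the
same quadratic piece of U. -/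
theorem StringFlow.hasDerivWithinAt_pos_succ (h : StringFlow n y g I t) {j : ℕ} (hj : j ≤ n) :
    HasDerivWithinAt (y (j + 1)) (((1 - y (j + 1) t) ^ 2 * leftSum (y · t) (g · t) j +
      (1 + y (j + 1) t) ^ 2 * rightSum n (y · t) (g · t) j) / 2) I t := by
  rcases hj.eq_or_lt with rfl | h1
  · have h0 : y (j + 1) = fun _ => 1 := funext h.right_end
    rw [rightSum_self, h0]
    simpa using hasDerivWithinAt_const t I (1 : ℝ)
  · convert h.pos (j + 1) (by omega) h1 using 1
    rw [leftSum_succ, rightSum_of_lt _ _ h1]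
    ring

/-- The Lax equation along the string. -/
theorem StringFlow.hasDerivWithinAt_string (h : StringFlow n y g I t) {z : ℝ} (hz : z ≠ 0)
    {l : ℕ → ℝ → ℝ} (hl : ∀ j s, l j s = y (j + 1) s - y j s) {j : ℕ} (hj : j ≤ n) :
    HasDerivWithinAt (fun s => (valPoly (l · s) (g · s) j).eval z)
      ((1 - y j t ^ 2) / z * (slopePoly (l · t) (g · t) j).eval z +
        (y j t / z + (-(1 - y j t) * leftSum (y · t) (g · t) j +
          (1 + y j t) * rightSum n (y · t) (g · t) j) / 2 - 1 / z) *
            (valPoly (l · t) (g · t) j).eval z) I t ∧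
    HasDerivWithinAt (fun s => (slopePoly (l · s) (g · s) j).eval z)
      ((-y j t / z - (-(1 - y j t) * leftSum (y · t) (g · t) j +
          (1 + y j t) * rightSum n (y · t) (g · t) j) / 2 - 1 / z) *
            (slopePoly (l · t) (g · t) j).eval z +
        (1 / z + (leftSum (y · t) (g · t) j + rightSum n (y · t) (g · t) j) / 2) *
            (valPoly (l · t) (g · t) j).eval z) I t := by
  -- In continuous form φ_t = ((1-η²)/z - U) φ_η + (η/z + U'/2 - 1/z) φ. The two formulas are this
  -- equation and its η-derivative, followed along y_j with the piece of U to its right. The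
  -- constant -1/z preserves the unit slope at -1.
  induction j with
  | zero =>
    simp only [valPoly_zero, slopePoly_zero, eval_zero, eval_one, h.left_end, leftSum_zero]
    constructor
    · simpa using hasDerivWithinAt_const t I (0 : ℝ)
    · exact (hasDerivWithinAt_const t I (1 : ℝ)).congr_deriv (by ring)
  | succ j ih =>
    obtain ⟨h1, h2⟩ := ih (by omega)
    have hv : HasDerivWithinAt (fun s => (valPoly (l · s) (g · s) (j + 1)).eval z) _ I t :=
      (h1.add (((h.hasDerivWithinAt_pos_succ (j := j) (by omega)).sub
        (h.hasDerivWithinAt_pos (j := j) (by omega))).mul h2)).congr_of_eventuallyEq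
        (Filter.Eventually.of_forall fun s => by
          simp [valPoly_succ, hl]) (by simp [valPoly_succ, hl])
    have hs : HasDerivWithinAt (fun s => (slopePoly (l · s) (g · s) (j + 1)).eval z) _ I t :=
      (h2.add (((h.mass j hj).const_mul z).mul hv)).congr_of_eventuallyEq
        (Filter.Eventually.of_forall fun s => by
          simp [slopePoly_succ, mul_comm z]) (by simp [slopePoly_succ, mul_comm z])
    constructor
    · convert hv using 1
      simp only [slopePoly_succ, valPoly_succ, eval_add, eval_mul, eval_C, eval_X, hl,
        leftSum_succ, rightSum_of_lt _ _ hj, Pi.sub_apply]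
      field_simp
      ring
    · convert hs using 1
      simp only [slopePoly_succ, valPoly_succ, eval_add, eval_mul, eval_C, eval_X, hl,
        leftSum_succ, rightSum_of_lt _ _ hj, Pi.sub_apply]
      field_simp
      ring

/-- `φ(1, z)` is a constant of motion. -/
theorem StringFlow.hasDerivWithinAt_valPoly_end (h : StringFlow n y g I t) {z : ℝ} (hz : z ≠ 0)
    {l : ℕ → ℝ → ℝ} (hl : ∀ j s, l j s = y (j + 1) s - y j s) :
    HasDerivWithinAt (fun s => (valPoly (l · s) (g · s) (n + 1)).eval z) 0 I t := by
  obtain ⟨h1, h2⟩ := h.hasDerivWithinAt_string hz hl le_rfl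
  have hv : HasDerivWithinAt (fun s => (valPoly (l · s) (g · s) (n + 1)).eval z) _ I t :=
    (h1.add (((h.hasDerivWithinAt_pos_succ le_rfl).sub
      (h.hasDerivWithinAt_pos le_rfl)).mul h2)).congr_of_eventuallyEq
      (Filter.Eventually.of_forall fun s => by
        simp [valPoly_succ, hl]) (by simp [valPoly_succ, hl])
  convert hv using 1
  simp only [rightSum_self, h.right_end, Pi.sub_apply]
  field_simp
  ring

/-- At an eigenvalue, the slope at the right end decays at the rate `2 / λ`. -/
theorem StringFlow.hasDerivWithinAt_slopePoly_end (h : StringFlow n y g I t) {z : ℝ} (hz : z ≠ 0)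
    {l : ℕ → ℝ → ℝ} (hl : ∀ j s, l j s = y (j + 1) s - y j s)
    (hroot : (valPoly (l · t) (g · t) (n + 1)).eval z = 0) :
    HasDerivWithinAt (fun s => (slopePoly (l · s) (g · s) n).eval z)
      (-2 / z * (slopePoly (l · t) (g · t) n).eval z) I t := by
  obtain ⟨-, h2⟩ := h.hasDerivWithinAt_string hz hl le_rfl
  convert h2 using 1
  -- At an eigenvalue φ is linear on the last interval and vanishes at 1.
  have h3 : (valPoly (l · t) (g · t) n).eval z =
      -(1 - y n t) * (slopePoly (l · t) (g · t) n).eval z := by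
    rw [valPoly_succ, eval_add, eval_mul, eval_C, hl, h.right_end] at hroot
    linear_combination hroot
  rw [h3, rightSum_self]
  field_simp
  ring

theorem eq_of_hasDerivWithinAt_zero {f : ℝ → ℝ} (hI : I.OrdConnected)
    (hf : ∀ t ∈ I, HasDerivWithinAt f 0 I t) {s t : ℝ} (hs : s ∈ I) (ht : t ∈ I) : f s = f t := by
  have := hI.convex.norm_image_sub_le_of_norm_hasDerivWithin_le (C := 0) hf (by simp) ht hs
  simpa [sub_eq_zero] using this

end Evolution

/-! ### The peakon equations in the variable `tanh x` -/

section Peakons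

/-- Since 1 ± tanh x = exp(±x)/cosh x, the exponential kernel factorizes into functions of the two
peaks; hence the velocity becomes piecewise quadratic on the string. -/
theorem exp_neg_mul_one_sub_tanh_sq (x x' : ℝ) :
    Real.exp (-2 * (x' - x)) * ((1 - Real.tanh x ^ 2) * (1 - Real.tanh x' ^ 2)) =
      (1 + Real.tanh x) ^ 2 * (1 - Real.tanh x') ^ 2 := by
  have h1 : ∀ x : ℝ, 1 + Real.tanh x = Real.exp x / Real.cosh x := fun x => by
    rw [Real.tanh_eq_sinh_div_cosh, ← Real.cosh_add_sinh]
    have := (Real.cosh_pos x).ne'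
    field_simp
  have h2 : ∀ x : ℝ, 1 - Real.tanh x = Real.exp (-x) / Real.cosh x := fun x => by
    rw [Real.tanh_eq_sinh_div_cosh, ← Real.cosh_sub_sinh]
    have := (Real.cosh_pos x).ne'
    field_simp
  have h3 : ∀ x : ℝ, 1 - Real.tanh x ^ 2 = (Real.cosh x ^ 2)⁻¹ := fun x => by
    have h4 : 1 - Real.tanh x ^ 2 = (1 + Real.tanh x) * (1 - Real.tanh x) := by ring
    rw [h4, h1, h2, div_mul_div_comm, ← Real.exp_add, add_neg_cancel, Real.exp_zero, pow_two,
      one_div]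
  have h5 : Real.exp (-2 * (x' - x)) = Real.exp x ^ 2 * Real.exp (-x') ^ 2 := by
    rw [← Real.exp_nat_mul, ← Real.exp_nat_mul, ← Real.exp_add]
    congr 1
    push_cast
    ring
  rw [h3, h3, h1, h2, h5, div_pow, div_pow]
  ring

theorem one_sub_tanh_sq_pos (x : ℝ) : 0 < 1 - Real.tanh x ^ 2 := by
  have h1 := Real.tanh_lt_one x
  have h2 := Real.neg_one_lt_tanh x
  nlinarith

theorem hasDerivAt_tanh (x : ℝ) : HasDerivAt Real.tanh (1 - Real.tanh x ^ 2) x := by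
  have hc := (Real.cosh_pos x).ne'
  have h : HasDerivAt (fun x => Real.sinh x / Real.cosh x) _ x :=
    (Real.hasDerivAt_sinh x).div (Real.hasDerivAt_cosh x) hc
  have h2 : (fun x => Real.sinh x / Real.cosh x) = Real.tanh :=
    funext fun x => (Real.tanh_eq_sinh_div_cosh x).symm
  rw [h2] at h
  convert h using 1
  rw [Real.tanh_eq_sinh_div_cosh]
  field_simp

variable {n : ℕ} {x m : ℕ → ℝ}

theorem stringPos_of_mem {j : ℕ} (h1 : 1 ≤ j) (hj : j ≤ n) :
    stringPos n x j = Real.tanh (x j) := by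
  rw [stringPos, if_neg (by omega), if_pos hj]

theorem stringMass_of_mem {j : ℕ} (h1 : 1 ≤ j) (hj : j ≤ n) :
    stringMass n x m j = m j / (1 - Real.tanh (x j) ^ 2) := by
  rw [stringMass, stringPos_of_mem h1 hj]

theorem mul_one_sub_tanh_sq_left {j k : ℕ} (h1 : 1 ≤ k) (hk : k ≤ n) :
    m k * Real.exp (-2 * (x j - x k)) * (1 - Real.tanh (x j) ^ 2) =
      (1 - Real.tanh (x j)) ^ 2 * (stringMass n x m k * (1 + stringPos n x k) ^ 2) := by
  have h := (one_sub_tanh_sq_pos (x k)).ne'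
  rw [stringMass_of_mem h1 hk, stringPos_of_mem h1 hk]
  have h2 := exp_neg_mul_one_sub_tanh_sq (x k) (x j)
  rw [div_mul_eq_mul_div, mul_div_assoc', eq_div_iff h]
  linear_combination m k * h2

theorem mul_one_sub_tanh_sq_right {j k : ℕ} (h1 : 1 ≤ k) (hk : k ≤ n) :
    m k * Real.exp (-2 * (x k - x j)) * (1 - Real.tanh (x j) ^ 2) =
      (1 + Real.tanh (x j)) ^ 2 * (stringMass n x m k * (1 - stringPos n x k) ^ 2) := by
  have h := (one_sub_tanh_sq_pos (x k)).ne'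
  rw [stringMass_of_mem h1 hk, stringPos_of_mem h1 hk]
  have h2 := exp_neg_mul_one_sub_tanh_sq (x j) (x k)
  rw [div_mul_eq_mul_div, mul_div_assoc', eq_div_iff h]
  linear_combination m k * h2

theorem sum_Icc_eq_add (f : ℕ → ℝ) {j : ℕ} (hj : j ≤ n) :
    ∑ k ∈ Finset.Icc 1 n, f k = ∑ k ∈ Finset.Icc 1 j, f k + ∑ k ∈ Finset.Ioc j n, f k := by
  have h : Finset.Icc 1 n = Finset.Icc 1 j ∪ Finset.Ioc j n := by
    ext k; simp only [Finset.mem_Icc, Finset.mem_union, Finset.mem_Ioc]; omega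
  rw [h, Finset.sum_union]
  exact Finset.disjoint_left.2 fun k hk hk' => by
    simp only [Finset.mem_Icc, Finset.mem_Ioc] at hk hk'; omega

theorem profile_mul (hx : ∀ i j, 1 ≤ i → i < j → j ≤ n → x i < x j) {j : ℕ} (h1 : 1 ≤ j)
    (hj : j ≤ n) :
    profile n x m (x j) * (1 - Real.tanh (x j) ^ 2) =
      ((1 - Real.tanh (x j)) ^ 2 * leftSum (stringPos n x) (stringMass n x m) j +
        (1 + Real.tanh (x j)) ^ 2 * rightSum n (stringPos n x) (stringMass n x m) j) / 2 := by
  rw [profile, sum_Icc_eq_add _ hj, leftSum, rightSum, Finset.mul_sum, Finset.mul_sum, mul_assoc,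
    add_mul, Finset.sum_mul, Finset.sum_mul, one_div, inv_mul_eq_div]
  congr 2
  · refine Finset.sum_congr rfl fun k hk => ?_
    rw [Finset.mem_Icc] at hk
    have hle : x k ≤ x j := by
      rcases hk.2.eq_or_lt with rfl | h
      · exact le_rfl
      · exact (hx k j hk.1 h hj).le
    rw [abs_of_nonneg (sub_nonneg.2 hle), mul_one_sub_tanh_sq_left hk.1 (hk.2.trans hj)]
  · refine Finset.sum_congr rfl fun k hk => ?_
    rw [Finset.mem_Ioc] at hk
    rw [abs_of_neg (sub_neg.2 (hx j k h1 hk.1 hk.2)), neg_sub,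
      mul_one_sub_tanh_sq_right (by omega) hk.2]

theorem meanSlope_mul (hx : ∀ i j, 1 ≤ i → i < j → j ≤ n → x i < x j) {j : ℕ} (hj : j + 1 ≤ n) :
    meanSlope n x m (x (j + 1)) * (1 - Real.tanh (x (j + 1)) ^ 2) =
      -((1 - Real.tanh (x (j + 1))) ^ 2 * leftSum (stringPos n x) (stringMass n x m) j) +
        (1 + Real.tanh (x (j + 1))) ^ 2 *
          rightSum n (stringPos n x) (stringMass n x m) (j + 1) := by
  rw [meanSlope, sum_Icc_eq_add _ hj, Finset.sum_Icc_succ_top (by omega), leftSum, rightSum,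
    Finset.mul_sum, Finset.mul_sum, sub_self, Real.sign_zero, mul_zero, zero_mul, add_zero,
    neg_add, add_mul, neg_mul, Finset.sum_mul, neg_mul, Finset.sum_mul, ← Finset.sum_neg_distrib
    (s := Finset.Ioc (j + 1) n)]
  congr 1
  · congr 1
    refine Finset.sum_congr rfl fun k hk => ?_
    rw [Finset.mem_Icc] at hk
    have hlt := sub_pos.2 (hx k (j + 1) hk.1 (by omega) hj)
    rw [abs_of_pos hlt, Real.sign_of_pos hlt, mul_one,
      mul_one_sub_tanh_sq_left (n := n) hk.1 (by omega)]
  · refine Finset.sum_congr rfl fun k hk => ?_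
    rw [Finset.mem_Ioc] at hk
    have hlt := sub_neg.2 (hx (j + 1) k (by omega) hk.1 hk.2)
    rw [abs_of_neg hlt, Real.sign_of_neg hlt, neg_sub, ← mul_one_sub_tanh_sq_right (by omega) hk.2]
    ring

/-- This matches the averaged slope in `StringFlow.mass` with the quotient rule for M/(1-T²). In
terms of G = M/(1-T²) the difference is a multiple of the hypothesis on u. -/
theorem mass_flow_identity {T M u S R : ℝ} (hT : 1 - T ^ 2 ≠ 0)
    (hu : u * (1 - T ^ 2) = -((1 - T) ^ 2 * S) + (1 + T) ^ 2 * R) :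
    ((1 - T) * (S + (S + M / (1 - T ^ 2) * (1 + T) ^ 2)) -
      (1 + T) * (R + M / (1 - T ^ 2) * (1 - T) ^ 2 + R)) / 2 * (M / (1 - T ^ 2)) =
    (-u * M * (1 - T ^ 2) - M * -(2 * T * (((1 - T) ^ 2 * (S + M / (1 - T ^ 2) * (1 + T) ^ 2) +
      (1 + T) ^ 2 * R) / 2))) / (1 - T ^ 2) ^ 2 := by
  obtain ⟨G, rfl⟩ : ∃ G, M = G * (1 - T ^ 2) := ⟨M / (1 - T ^ 2), (div_mul_cancel₀ _ hT).symm⟩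
  rw [mul_div_cancel_right₀ _ hT, eq_div_iff (pow_ne_zero 2 hT)]
  linear_combination G * (1 - T ^ 2) * hu

theorem IsSolution.stringFlow {x m : ℕ → ℝ → ℝ} {I : Set ℝ} (h : IsSolution n x m I) {t : ℝ}
    (ht : t ∈ I) :
    StringFlow n (fun j s => stringPos n (fun k => x k s) j)
      (fun j s => stringMass n (fun k => x k s) (fun k => m k s) j) I t := by
  have hpos : ∀ j, 1 ≤ j → j ≤ n → HasDerivWithinAt (fun s => Real.tanh (x j s))
      (((1 - Real.tanh (x j t)) ^ 2 * leftSum (stringPos n fun k => x k t)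
          (stringMass n (fun k => x k t) (fun k => m k t)) j +
        (1 + Real.tanh (x j t)) ^ 2 * rightSum n (stringPos n fun k => x k t)
          (stringMass n (fun k => x k t) (fun k => m k t)) j) / 2) I t := fun j h1 hj => by
    rw [← profile_mul (x := fun k => x k t) (m := fun k => m k t) (h.ordered t ht) h1 hj, mul_comm]
    exact (hasDerivAt_tanh _).comp_hasDerivWithinAt t (h.pos_ode t ht j h1 hj)
  refine ⟨fun s => rfl, fun s => by simp [stringPos], fun j h1 hj => ?_, fun j hj => ?_⟩
  · simp only [stringPos_of_mem h1 hj]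
    exact hpos j h1 hj
  · have h1 : 1 ≤ j + 1 := by omega
    have hT := one_sub_tanh_sq_pos (x (j + 1) t)
    have hd : HasDerivWithinAt (fun s => m (j + 1) s / (1 - Real.tanh (x (j + 1) s) ^ 2)) _ I t :=
      (h.weight_ode t ht (j + 1) h1 hj).div (((hpos (j + 1) h1 hj).pow 2).const_sub 1) hT.ne'
    simp only [stringPos_of_mem h1 hj, stringMass_of_mem h1 hj]
    convert hd using 1
    have hms := meanSlope_mul (x := fun k => x k t) (m := fun k => m k t) (h.ordered t ht) hj
    rw [leftSum_succ, rightSum_of_lt _ _ hj] at *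
    simp only [stringPos_of_mem h1 hj, stringMass_of_mem h1 hj] at *
    refine (mass_flow_identity (M := m (j + 1) t) hT.ne' hms).trans ?_
    simp only [Nat.cast_ofNat, Nat.reduceSub, pow_one]

end Peakons

/-! ### Order of the knots and total length -/

section Peakons

theorem tanh_strictMono : StrictMono Real.tanh :=
  strictMono_of_deriv_pos fun x => by
    rw [(hasDerivAt_tanh x).deriv]
    exact one_sub_tanh_sq_pos x

theorem stringPos_lt_succ {n : ℕ} {x : ℕ → ℝ}
    (hx : ∀ i j, 1 ≤ i → i < j → j ≤ n → x i < x j) {j : ℕ} (hj : j ≤ n) :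
    stringPos n x j < stringPos n x (j + 1) := by
  have hlast : stringPos n x (n + 1) = 1 := by simp [stringPos]
  rcases Nat.eq_zero_or_pos j with rfl | h1
  · have h0 : stringPos n x 0 = -1 := rfl
    rw [h0]
    rcases Nat.eq_zero_or_pos n with rfl | hn
    · rw [hlast]; norm_num
    · rw [stringPos_of_mem le_rfl (by omega)]
      exact Real.neg_one_lt_tanh _
  · rw [stringPos_of_mem h1 hj]
    rcases hj.eq_or_lt with rfl | hjn
    · rw [hlast]
      exact Real.tanh_lt_one _
    · rw [stringPos_of_mem (by omega) hjn]
      exact tanh_strictMono (hx j (j + 1) h1 (by omega) hjn)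

theorem sum_stringLen (n : ℕ) (x : ℕ → ℝ) (j : ℕ) :
    ∑ i ∈ Finset.range j, stringLen n x i = stringPos n x j + 1 := by
  simp only [stringLen]
  rw [Finset.sum_range_sub]
  simp [stringPos]

end Peakons

/-! ### Residues and spectral data -/

section Spectral

variable {n : ℕ} {l g lam : ℕ → ℝ}

/-- The diagonal Christoffel–Darboux identity replaces N by z φ_z(1,z) D_n(z). The residue becomes
linear in D_n, over a denominator that depends on φ(1,·) alone. -/
theorem residue_eq_div (hl : ∀ j ≤ n, 0 < l j) {z : ℝ}
    (hz : (valPoly l g (n + 1)).eval z = 0) :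
    residue n l g z = (slopePoly l g n).eval z /
      (z * (derivative (valPoly l g (n + 1))).eval z) ∧
      (slopePoly l g n).eval z ≠ 0 := by
  have h := derivative_valPoly_mul hz
  have hN := (normSq_pos (g := g) hl z).ne'
  rw [← h] at hN
  refine ⟨?_, right_ne_zero_of_mul hN⟩
  rw [residue, ← h, pow_two, mul_div_mul_right _ _ (right_ne_zero_of_mul hN)]

theorem residue_pos (hl : ∀ j ≤ n, 0 < l j) {z : ℝ}
    (hz : (valPoly l g (n + 1)).eval z = 0) : 0 < residue n l g z :=
  div_pos (sq_pos_of_ne_zero (residue_eq_div hl hz).2) (normSq_pos hl z)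

theorem waveEnd_ofReal (z : ℝ) :
    waveEnd n l g z = ((valPoly l g (n + 1)).eval z : ℝ) := by
  rw [waveEnd_eq]
  simpa using aeval_algebraMap_apply ℂ z (valPoly l g (n + 1))

/-- The enumerated eigenvalues and the residues are spectral data of the string. -/
theorem isSpectralData (hsum : ∑ i ∈ Finset.range (n + 1), l i = 2) (hl : ∀ j ≤ n, 0 < l j)
    (hlam : ∀ i j, 1 ≤ i → i < j → j ≤ n → lam i ≠ lam j)
    (hroots : ∀ z : ℂ, waveEnd n l g z = 0 ↔ ∃ j, 1 ≤ j ∧ j ≤ n ∧ z = lam j)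
    {a : ℕ → ℝ} (ha : ∀ j, 1 ≤ j → j ≤ n → a j = residue n l g (lam j)) :
    IsSpectralData n l g lam a ∧
      (∀ i j, i < j → j ≤ n → node lam i ≠ node lam j) ∧
      ∀ k ≤ n, node lam k * (valPoly l g (n + 1)).eval (node lam k) = 0 := by
  have hval : ∀ j, 1 ≤ j → j ≤ n → (valPoly l g (n + 1)).eval (lam j) = 0 := fun j h1 hj => by
    have := (hroots (lam j)).2 ⟨j, h1, hj, rfl⟩
    rw [waveEnd_ofReal] at this
    exact_mod_cast this
  -- φ(1,0) is the total length 2.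
  have hne : ∀ j, 1 ≤ j → j ≤ n → lam j ≠ 0 := fun j h1 hj h0 => by
    have := hval j h1 hj
    rw [h0, eval_zero_valPoly, hsum] at this
    norm_num at this
  have hinj : ∀ i j, i < j → j ≤ n → node lam i ≠ node lam j := fun i j hij hj => by
    rw [node_of_pos lam (show 1 ≤ j by omega)]
    rcases Nat.eq_zero_or_pos i with rfl | hi
    · exact (hne j (by omega) hj).symm
    · rw [node_of_pos lam hi]
      exact hlam i j hi hij hj
  have hroot : ∀ k ≤ n, node lam k * (valPoly l g (n + 1)).eval (node lam k) = 0 := fun k hk => by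
    rcases Nat.eq_zero_or_pos k with rfl | h1
    · simp
    · rw [node_of_pos lam h1, hval k h1 hk, mul_zero]
  refine ⟨⟨hne, hlam, hroots, fun z hz hz0 => ?_⟩, hinj, hroot⟩
  rw [weyl_div_eq hl hinj hroot (fun k hk => ?_) hz0, Finset.sum_range_succ', node_zero,
    residue_zero hsum, add_comm]
  · congr 1
    · push_cast
      rw [sub_zero, div_div]
    · rw [Finset.range_eq_Ico, Finset.sum_Ico_add' (fun k =>
        (residue n l g (node lam k) : ℂ) / (z - node lam k))]
      refine Finset.sum_congr (by ext; simp) fun k hk => ?_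
      rw [Finset.mem_Icc] at hk
      rw [node_of_pos lam (by omega), ha k (by omega) (by omega)]
  · rcases Nat.eq_zero_or_pos k with rfl | h1
    · simpa using hz
    · rw [node_of_pos lam h1]
      exact fun h => hz0 ((hroots z).2 ⟨k, h1, hk, h⟩)

end Spectral

/-! ### Conservation of the spectrum and decay of the end slope -/

section Isospectral

variable {n : ℕ} {y g l : ℕ → ℝ → ℝ} {I : Set ℝ}

/-- The polynomial `φ(1, ·)` is a constant of motion. -/
theorem valPoly_end_eq (hI : I.OrdConnected) (h : ∀ t ∈ I, StringFlow n y g I t)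
    (hl : ∀ j s, l j s = y (j + 1) s - y j s) {s t : ℝ} (hs : s ∈ I) (ht : t ∈ I) :
    valPoly (l · s) (g · s) (n + 1) = valPoly (l · t) (g · t) (n + 1) := by
  -- The Lax equation has a pole at z = 0, but equality at the remaining points determines the
  -- polynomial.
  have hne : Set.Infinite {z : ℝ | z ≠ 0} := (Set.finite_singleton (0 : ℝ)).infinite_compl
  refine eq_of_infinite_eval_eq _ _ (hne.mono fun z hz => ?_)
  exact eq_of_hasDerivWithinAt_zero hI
    (f := fun s => (valPoly (l · s) (g · s) (n + 1)).eval z)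
    (fun t ht => (h t ht).hasDerivWithinAt_valPoly_end hz hl) hs ht

/-- The exponential decay of the slope at the right end at an eigenvalue. -/
theorem slopePoly_end_eq (hI : I.OrdConnected) (h : ∀ t ∈ I, StringFlow n y g I t)
    (hl : ∀ j s, l j s = y (j + 1) s - y j s) {z : ℝ} (hz : z ≠ 0) {s t : ℝ} (hs : s ∈ I)
    (ht : t ∈ I) (hroot : (valPoly (l · s) (g · s) (n + 1)).eval z = 0) :
    (slopePoly (l · t) (g · t) n).eval z =
      (slopePoly (l · s) (g · s) n).eval z * Real.exp (2 * s / z) * Real.exp (-2 * t / z) := by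
  -- The integrating factor exp(2s/z) makes the slope constant in time.
  have hder : ∀ t ∈ I, HasDerivWithinAt
      (fun s => (slopePoly (l · s) (g · s) n).eval z * Real.exp (2 * s / z)) 0 I t := by
    intro t ht
    have h1 := (h t ht).hasDerivWithinAt_slopePoly_end hz hl
      (by rw [← valPoly_end_eq hI h hl hs ht]; exact hroot)
    have h2 : HasDerivWithinAt (fun s : ℝ => Real.exp (2 * s / z))
        (Real.exp (2 * t / z) * (2 * 1 / z)) I t :=
      (((hasDerivAt_id t).const_mul 2).div_const z).exp.hasDerivWithinAt
    exact (h1.mul h2).congr_deriv (by ring)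
  have h3 := eq_of_hasDerivWithinAt_zero hI hder hs ht
  rw [h3, mul_assoc, ← Real.exp_add]
  have : 2 * t / z + -2 * t / z = 0 := by ring
  rw [this, Real.exp_zero, mul_one]

end Isospectral

end Multipeakon

end

/-! ### Assembly of the theorem -/

open Multipeakon in
theorem theorem6p1 (n : ℕ) (x m : ℕ → ℝ → ℝ) (I : Set ℝ) (hI : I.OrdConnected)
    (h : Multipeakon.IsSolution n x m I) :
    ∃ lam c : ℕ → ℝ, (∀ j, 1 ≤ j → j ≤ n → 0 < c j) ∧
      ∀ t ∈ I,
        let y : ℕ → ℝ := Multipeakon.stringPos n (fun k => x k t)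
        let l : ℕ → ℝ := Multipeakon.stringLen n (fun k => x k t)
        let g : ℕ → ℝ := Multipeakon.stringMass n (fun k => x k t) (fun k => m k t)
        let a : ℕ → ℝ := fun j => c j * Real.exp (-2 * t / lam j)
        let μ : MeasureTheory.Measure ℝ := Multipeakon.spectralMeasure n lam a
        let P : ℕ → Polynomial ℝ := Multipeakon.orthoPoly μ
        let b : ℕ → ℝ := Multipeakon.recCoeff μ
        Multipeakon.IsSpectralData n l g lam a ∧
        Multipeakon.IsOrthonormalUpTo μ n P ∧
        (∀ j, j ≤ n → l j = (P (n - j)).eval 0 ^ 2) ∧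
        (∀ j, 1 ≤ j → j ≤ n →
          g j = -1 / (b (n - j) * (P (n - j + 1)).eval 0 * (P (n - j)).eval 0)) ∧
        (∀ j, 1 ≤ j → j ≤ n →
          y j = 1 + b (n - j) *
            ((P (n - j)).derivative.eval 0 * (P (n - j + 1)).eval 0 -
              (P (n - j)).eval 0 * (P (n - j + 1)).derivative.eval 0)) := by
  rcases I.eq_empty_or_nonempty with rfl | ⟨t₀, ht₀⟩
  · exact ⟨0, 1, fun _ _ _ => one_pos, fun t ht => ht.elim⟩
  set L : ℕ → ℝ → ℝ := fun j s => stringLen n (fun k => x k s) j with hL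
  set G : ℕ → ℝ → ℝ := fun j s => stringMass n (fun k => x k s) (fun k => m k s) j with hG
  have hflow : ∀ t ∈ I, StringFlow n (fun j s => stringPos n (fun k => x k s) j) G I t :=
    fun t ht => h.stringFlow ht
  have hlen : ∀ j s, L j s =
      stringPos n (fun k => x k s) (j + 1) - stringPos n (fun k => x k s) j := fun _ _ => rfl
  have hpos : ∀ t ∈ I, ∀ j ≤ n, 0 < L j t := fun t ht j hj =>
    sub_pos.2 (stringPos_lt_succ (h.ordered t ht) hj)
  have hmass : ∀ t ∈ I, ∀ j, 1 ≤ j → j ≤ n → G j t ≠ 0 := fun t ht j h1 hj => by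
    simp only [hG]
    rw [stringMass_of_mem h1 hj]
    exact div_ne_zero (h.weight_ne t ht j h1 hj) (one_sub_tanh_sq_pos _).ne'
  have hsum : ∀ t, ∑ i ∈ Finset.range (n + 1), L i t = 2 := fun t => by
    have : stringPos n (fun k => x k t) (n + 1) = 1 := by simp [stringPos]
    simp only [hL]
    rw [sum_stringLen, this]
    norm_num
  obtain ⟨lam, hlam, hroots⟩ := exists_enum_eigenvalues (hpos t₀ ht₀) (hmass t₀ ht₀)
  have hval : ∀ j, 1 ≤ j → j ≤ n → (valPoly (L · t₀) (G · t₀) (n + 1)).eval (lam j) = 0 :=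
    fun j h1 hj => by
      have := (hroots (lam j)).2 ⟨j, h1, hj, rfl⟩
      rw [waveEnd_ofReal] at this
      exact_mod_cast this
  have hlam0 := (isSpectralData (hsum t₀) (hpos t₀ ht₀) hlam hroots (fun _ _ _ => rfl)).1.ne_zero
  -- The factor exp(2t₀/λ_j) shifts the residue at the reference time t₀ to the normalization at
  -- time 0, which need not lie in `I`.
  refine ⟨lam, fun j => residue n (L · t₀) (G · t₀) (lam j) * Real.exp (2 * t₀ / lam j),
    fun j h1 hj => mul_pos (residue_pos (hpos t₀ ht₀) (hval j h1 hj)) (Real.exp_pos _),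
    fun t ht => ?_⟩
  intro y l g a μ P b
  have hend : valPoly (L · t) (G · t) (n + 1) = valPoly (L · t₀) (G · t₀) (n + 1) :=
    valPoly_end_eq hI hflow hlen ht ht₀
  -- The residues at t and t₀ share the denominator λ φ_z(1,λ), so their ratio is that of the end
  -- slopes.
  have ha : ∀ j, 1 ≤ j → j ≤ n → a j = residue n l g (lam j) := fun j h1 hj => by
    have hv := hval j h1 hj
    have hr := (residue_eq_div (hpos t₀ ht₀) hv).1
    have hr' := (residue_eq_div (hpos t ht) (by rw [hend]; exact hv)).1
    have hs := slopePoly_end_eq hI hflow hlen (hlam0 j h1 hj) ht₀ ht hv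
    rw [hs, hend] at hr'
    refine Eq.trans ?_ hr'.symm
    simp only [a]
    rw [hr]
    ring
  have hrootsₜ : ∀ z : ℂ, waveEnd n l g z = 0 ↔ ∃ j, 1 ≤ j ∧ j ≤ n ∧ z = lam j := fun z => by
    rw [← hroots z, waveEnd_eq, waveEnd_eq, ← hend]
  obtain ⟨hspec, hinj, hroot⟩ := isSpectralData (hsum t) (hpos t ht) hlam hrootsₜ ha
  obtain ⟨h1, h2, h3⟩ :=
    reconstruction_formulas (hsum t) (hpos t ht) (hmass t ht) hinj hroot ha
  refine ⟨hspec, (reconstruction (hsum t) (hpos t ht) (hmass t ht) hinj hroot ha).1, h1, h2,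
    fun j hj1 hj => ?_⟩
  have h4 := h3 j hj1 hj
  have h5 : ∑ i ∈ Finset.range j, L i t = y j + 1 := sum_stringLen n _ j
  rw [h5] at h4
  linear_combination h4
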